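/- Let $(\Omega,\mathcal F,\mathbb P)$ be a probability space with a filtration $(\mathcal F_t)_{t\in[0,1]}$ that admits, for each $t\in[0,1)$, a regular conditional probability given $\mathcal F_t$; $\mathbb E[\,\cdot\,|\mathcal F_t]$ denotes the expectation under it. Let $W$ be a standard $k$-dimensional $(\mathcal F_t)$-Brownian motion on $[0,1]$ (for instance, with $(\mathcal F_t)$ generated by $W$). Let $\gamma,c\in[0,\infty)$ with $c+\gamma>0$, and for $a\ge 0$ put $$\mathcal U^{a}_t(F)=-\tfrac1a\log\mathbb E[e^{-aF}|\mathcal F_t]\quad(a>0),\qquad \mathcal U^{0}_t(F)=\mathbb E[F|\mathcal F_t],$$ and $\Pi_t=\mathcal U^{\gamma}_t$, $U_t=\mathcal U^{c}_t$, $U^*_t=\mathcal U^{c\gamma/(c+\gamma)}_t$. Let $s:\mathbb R^k\to\mathbb R^d$ and $g,h:\mathbb R^k\to\mathbb R$ be Borel, and let $S=s(W_1)$, $G=g(W_1)$, $H=h(W_1)$ have finite exponential moments of all orders: $\mathbb E[e^{a|F|}]<\infty$ for all $a>0$ and $F\in\{S,G,H\}$. Write $yS$ for the inner product of $y\in\mathbb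 R^d$ and $S$. The utility indifference price of the volume $y$ at time $t$ for a supplier with inventory $z$ is $$P_t(z,y)=\inf\{q\in\mathbb R:\ \Pi_t(G+zS-yS+q)\ge\Pi_t(G+zS)\}.$$ Let $A\subset\mathbb R^d$ be compact with $0\in A$. For $n\ge1$ define recursively, for $x\in\mathbb R$ and $z\in -A$, $V^n_t(x,z)=H+x-zS$ if $t\ge1$, and for $t\in[0,1)$, with $j=\lfloor nt\rfloor$, $$V^n_t(x,z)=\sup_{y\in A+z}U_{j/n}\Bigl(V^n_{(j+1)/n}\bigl(x-P_{j/n}(z,y),\,z-y\bigr)\Bigr).$$ For $t\in[0,1]$, $w\in\mathbb R^k$, $y\in\mathbb R^d$ let $v(t,w)$ and $p(t,w,y)$ be the exponential utilities with risk aversion $\frac{c\gamma}{c+\gamma}$, respectively $\gamma$, of $g(X)+h(X)$, respectively $g(X)-y\,s(X)$, where $X$ has the normal law $N(w,(1-t)I_k)$, the conditional law of $W_1$ given $W_t=w$. Thus, if $c,\gamma>0$, $$v(t,w)=-\tfrac{c+\gamma}{c\gamma}\log\mathbb E\bigl[e^{-\frac{c\gamma}{c+\gamma}(G+H)}\big|W_t=w\bigr],\qquad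 p(t,w,y)=-\tfrac1\gamma\log\mathbb E\bigl[e^{-\gamma(G-yS)}\big|W_t=w\bigr].$$ Assume that the derivatives $\partial_t$, $\partial_{w_i}$, $\partial_{w_i}\partial_{w_j}$ of $v$ exist and are bounded and uniformly continuous on $[0,1]\times\mathbb R^k$, and those of $p$ on $[0,1]\times\mathbb R^k\times A$ (one-sided $t$-derivatives at $t=0,1$). Assume the completeness condition: there is a measurable map $y^\dagger:\mathbb R^k\times[0,1]\times\mathbb R^k\to\mathbb R^d$ with $$-\nabla_w p\bigl(t,w,y^\dagger(w,t,z)\bigr)=z\qquad\text{for all }(z,t,w)\in\mathbb R^k\times[0,1]\times\mathbb R^k,$$ and assume that $A$ is large enough to contain the values of the optimal strategy: $$y^\dagger\bigl(w,t,-\tfrac{c}{c+\gamma}\nabla_w v(t,w)\bigr)\in A\qquad\text{for all }(t,w)\in[0,1]\times\mathbb R^k.$$ Then, almost surely, $$\lim_{n\to\infty}V^n_0(0,0)=v(0,W_0)-p(0,W_0,0)=U^*_0(G+H)-\Pi_0(G).$$ -/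

import Mathlib

open MeasureTheory ProbabilityTheory Filter Topology Set

noncomputable section

namespace IndifferencePricing

/-- `ℝ^n` with its Euclidean structure. -/
abbrev E (n : ℕ) : Type := EuclideanSpace ℝ (Fin n)

/-- Exponential utility (certainty equivalent) with risk aversion `a` under the law `μ`;
the value at `a = 0` is the limit as `a → 0`, the expectation. -/
def expUtility {α : Type*} [MeasurableSpace α] (a : ℝ) (μ : Measure α) (F : α → ℝ) : ℝ :=
  if a = 0 then ∫ x, F x ∂μ else -(1 / a) * Real.log (∫ x, Real.exp (-a * F x) ∂μ)

/-- The normal law `N(w, r I)` on `ℝ^k`: the law of a Brownian motion after time `r ≥ 0`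
when it starts at `w`. -/
def brownianKernel {k : ℕ} (r : ℝ) (w : E k) : Measure (E k) :=
  (stdGaussian (E k)).map (fun x => w + Real.sqrt r • x)

section Probability

variable {Ω : Type*} [mΩ : MeasurableSpace Ω]

/-- `W` is a standard `k`-dimensional `𝓕`-Brownian motion on the time interval `[0,1]`. Only the
restrictions of `𝓕` and `W` to `[0,1]` matter. -/
structure IsBrownianMotion {k : ℕ} (P : Measure Ω) (𝓕 : Filtration ℝ mΩ) (W : ℝ → Ω → E k) :
    Prop where
  adapted : ∀ t ∈ Icc (0 : ℝ) 1, Measurable[𝓕 t] (W t)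
  zero : ∀ᵐ ω ∂P, W 0 ω = 0
  indep : ∀ s t : ℝ, 0 ≤ s → s ≤ t → t ≤ 1 →
    Indep (MeasurableSpace.comap (fun ω => W t ω - W s ω) inferInstance) (𝓕 s) P
  law : ∀ s t : ℝ, 0 ≤ s → s ≤ t → t ≤ 1 →
    P.map (fun ω => W t ω - W s ω) = brownianKernel (t - s) 0
  continuous_paths : ∀ᵐ ω ∂P, ContinuousOn (fun t => W t ω) (Icc (0 : ℝ) 1)

/-- `κ t` is a regular conditional probability given `𝓕 t`, for each `t ∈ [0,1)`. -/
structure IsRegularCondProb (P : Measure Ω) (𝓕 : Filtration ℝ mΩ) (κ : ℝ → Ω → Measure Ω) :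
    Prop where
  isProbabilityMeasure : ∀ t ∈ Ico (0 : ℝ) 1, ∀ ω, IsProbabilityMeasure (κ t ω)
  measurable : ∀ t ∈ Ico (0 : ℝ) 1, ∀ B : Set Ω, MeasurableSet B →
    Measurable[𝓕 t] (fun ω => κ t ω B)
  condExp : ∀ t ∈ Ico (0 : ℝ) 1, ∀ B : Set Ω, MeasurableSet B →
    (fun ω => (κ t ω).real B) =ᵐ[P] P[B.indicator (fun _ => (1 : ℝ)) | 𝓕 t]

/-- All exponential moments of (the norm of) `F` are finite. -/
def HasExpMoments {V : Type*} [NormedAddCommGroup V] (P : Measure Ω) (F : Ω → V) : Prop :=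
  ∀ a : ℝ, 0 < a → Integrable (fun ω => Real.exp (a * ‖F ω‖)) P

/-- Conditional exponential utility at time `t` of the cash-flow `F`, expectations being taken
under the regular conditional probability. -/
def condUtility (κ : ℝ → Ω → Measure Ω) (a t : ℝ) (F : Ω → ℝ) (ω : Ω) : ℝ :=
  expUtility a (κ t ω) F

/-- Utility indifference price at time `t` of the volume `y`, quoted by the supplier with risk
aversion `γ` and endowment `G` when she holds `z` units of the securities `S`. -/
def price {d : ℕ} (κ : ℝ → Ω → Measure Ω) (γ : ℝ) (G : Ω → ℝ) (S : Ω → E d)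
    (t : ℝ) (z y : E d) (ω : Ω) : ℝ :=
  sInf {q : ℝ | condUtility κ γ t (fun ω' => G ω' + inner ℝ z (S ω')) ω ≤
    condUtility κ γ t (fun ω' => G ω' + inner ℝ z (S ω') - inner ℝ y (S ω') + q) ω}

/-- Dynamic programming value with `m` of the `n` trading dates left, i.e. at time `(n - m) / n`.
Here `x` is the cash of the demander (risk aversion `c`, endowment `H`) and `z ∈ -A` is the
inventory of the supplier, so the demander holds `-z`; after the demander buys `y ∈ A + z` the
inventory of the supplier is `z - y ∈ -A`. -/
def dpRemaining {d : ℕ} (κ : ℝ → Ω → Measure Ω) (γ c : ℝ) (A : Set (E d)) (G H : Ω → ℝ)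
    (S : Ω → E d) (n : ℕ) : ℕ → ℝ → E d → Ω → ℝ
  | 0, x, z, ω => H ω + x - inner ℝ z (S ω)
  | m + 1, x, z, ω =>
      sSup ((fun y : E d =>
        condUtility κ c (((n : ℝ) - ((m : ℝ) + 1)) / n)
          (fun ω' => dpRemaining κ γ c A G H S n m
            (x - price κ γ G S (((n : ℝ) - ((m : ℝ) + 1)) / n) z y ω') (z - y) ω') ω)
        '' {y : E d | y - z ∈ A})

/-- The value `V^n_t(x, z)`: terminal value `H + x - zS` for `t ≥ 1`, and for `t < 1` the supremum
over `y ∈ A + z` of `U_{j/n}(V^n_{(j+1)/n}(x - P_{j/n}(z, y), z - y))` with `j = ⌊n t⌋`. -/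
def dpValue {d : ℕ} (κ : ℝ → Ω → Measure Ω) (γ c : ℝ) (A : Set (E d)) (G H : Ω → ℝ)
    (S : Ω → E d) (n : ℕ) (t x : ℝ) (z : E d) (ω : Ω) : ℝ :=
  dpRemaining κ γ c A G H S n (n - ⌊(n : ℝ) * t⌋₊) x z ω

end Probability

section Markov

variable {k d : ℕ}

/-- `v(t, w)`: the exponential utility with risk aversion `cγ/(c+γ)` of `(g + h)(W_1)` given
`W_t = w`. -/
def vFun (γ c : ℝ) (g h : E k → ℝ) (t : ℝ) (w : E k) : ℝ :=
  expUtility (c * γ / (c + γ)) (brownianKernel (1 - t) w) (fun x => g x + h x)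

/-- `p(t, w, y)`: the exponential utility with risk aversion `γ` of `(g - y s)(W_1)` given
`W_t = w`. -/
def pFun (γ : ℝ) (g : E k → ℝ) (s : E k → E d) (t : ℝ) (w : E k) (y : E d) : ℝ :=
  expUtility γ (brownianKernel (1 - t) w) (fun x => g x - inner ℝ y (s x))

/-- The derivatives of `f (t, w, y)` of order one in `t` and of orders one and two in `w` exist and
are bounded and uniformly continuous on `[0,1] × ℝ^k × B` (one-sided in `t` at the end points). -/
structure HasRegularDerivs {Y : Type*} [UniformSpace Y] (B : Set Y) (f : ℝ → E k → Y → ℝ) :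
    Prop where
  differentiable_time : ∀ w : E k, ∀ y ∈ B, DifferentiableOn ℝ (fun t => f t w y) (Icc 0 1)
  contDiff_space : ∀ t ∈ Icc (0 : ℝ) 1, ∀ y ∈ B, ContDiff ℝ 2 (fun w => f t w y)
  bounded : ∃ C : ℝ, ∀ t ∈ Icc (0 : ℝ) 1, ∀ w : E k, ∀ y ∈ B,
    |derivWithin (fun t' => f t' w y) (Icc 0 1) t| ≤ C ∧
    ‖gradient (fun w' => f t w' y) w‖ ≤ C ∧
    ‖fderiv ℝ (gradient (fun w' => f t w' y)) w‖ ≤ C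
  uniform_time : UniformContinuousOn
    (fun q : ℝ × E k × Y => derivWithin (fun t' => f t' q.2.1 q.2.2) (Icc 0 1) q.1)
    (Icc 0 1 ×ˢ univ ×ˢ B)
  uniform_gradient : UniformContinuousOn
    (fun q : ℝ × E k × Y => gradient (fun w' => f q.1 w' q.2.2) q.2.1)
    (Icc 0 1 ×ˢ univ ×ˢ B)
  uniform_hessian : UniformContinuousOn
    (fun q : ℝ × E k × Y => fderiv ℝ (gradient (fun w' => f q.1 w' q.2.2)) q.2.1)
    (Icc 0 1 ×ˢ univ ×ˢ B)

/-- Completeness condition: `yd` is measurable and `-∇p(t, w, yd(w, t, z)) = z` for all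
`(z, t, w) ∈ ℝ^k × [0,1] × ℝ^k`, where `∇` is the gradient in `w`. -/
structure IsCompletenessMap (γ : ℝ) (g : E k → ℝ) (s : E k → E d)
    (yd : E k × ℝ × E k → E d) : Prop where
  measurable : Measurable yd
  hasGradientAt : ∀ z : E k, ∀ t ∈ Icc (0 : ℝ) 1, ∀ w : E k,
    HasGradientAt (fun w' => pFun γ g s t w' (yd (w, t, z))) (-z) w

end Markov

end IndifferencePricing

end

/-! Cash invariance turns the price into `p(t,w,-z) - p(t,w,y-z)`. Hence the value with cash `x` and
inventory `z` is `x - p(t,W_t,-z) + q(W_t)`, where `q` no longer depends on `x` or `z` and solves a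
Markovian recursion over the position `u = y - z ∈ A` (`dpRemaining_eq`).

By time consistency of `p`, one step of this recursion is the total utility of splitting the
continuation value `V` into `F = p(t+δ,·,u)` for the supplier and `V - F` for the demander. Optimal
risk sharing bounds it by the utility of `V` with risk aversion `cγ/(c+γ)` (`sharing_le`), so `q ≤
v` by induction.

The bound is attained when `F - θV` is constant, `θ = c/(c+γ)`; otherwise the loss is quadratic in
the residual (`le_sharing`). Completeness provides `u` with `∇p = θ∇v` at `(t,w)`. With this `u`,
the residual over a step of length `δ` is `o(√δ)`, so the loss is `o(δ)` uniformly
(`exists_le_step`), and `n = 1/δ` steps lose `o(1)` in total. -/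

namespace IndifferencePricing

/-! ### Functions with all exponential moments -/

section ExpIntegrable

variable {α : Type*} [MeasurableSpace α] {μ : Measure α} {F G : α → ℝ}

/-- All exponential moments of the real function `F`, of either sign, are finite. -/
def ExpIntegrable (μ : Measure α) (F : α → ℝ) : Prop :=
  ∀ b : ℝ, Integrable (fun x => Real.exp (b * F x)) μ

lemma ExpIntegrable.aemeasurable (hF : ExpIntegrable μ F) : AEMeasurable F μ := by
  have := (hF 1).1.aemeasurable
  simp only [one_mul] at this
  exact Real.aemeasurable_of_aemeasurable_exp this

lemma ExpIntegrable.exp_abs (hF : ExpIntegrable μ F) (b : ℝ) :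
    Integrable (fun x => Real.exp (b * |F x|)) μ := by
  refine ((hF b).add (hF (-b))).mono'
    (hF.aemeasurable.abs.const_mul b).exp.aestronglyMeasurable (ae_of_all _ fun x => ?_)
  have h1 := Real.exp_pos (b * F x)
  have h2 := Real.exp_pos (-b * F x)
  rw [Real.norm_of_nonneg (Real.exp_pos _).le]
  rcases abs_cases (F x) with ⟨h, -⟩ | ⟨h, -⟩ <;> simp only [h, Pi.add_apply]
  · linarith
  · rw [show b * -F x = -b * F x by ring]; linarith

lemma ExpIntegrable.integrable (hF : ExpIntegrable μ F) : Integrable F μ := by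
  refine (hF.exp_abs 1).mono' hF.aemeasurable.aestronglyMeasurable (ae_of_all _ fun x => ?_)
  rw [Real.norm_eq_abs, one_mul]
  linarith [Real.add_one_le_exp |F x|]

lemma ExpIntegrable.add (hF : ExpIntegrable μ F) (hG : ExpIntegrable μ G) :
    ExpIntegrable μ (fun x => F x + G x) := fun b => by
  refine ((hF (2 * b)).add (hG (2 * b))).mono'
    ((hF.aemeasurable.add hG.aemeasurable).const_mul b).exp.aestronglyMeasurable
    (ae_of_all _ fun x => ?_)
  rw [Real.norm_of_nonneg (Real.exp_pos _).le, mul_add, Real.exp_add, Pi.add_apply,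
    show 2 * b * F x = b * F x + b * F x by ring, show 2 * b * G x = b * G x + b * G x by ring,
    Real.exp_add, Real.exp_add]
  nlinarith [sq_nonneg (Real.exp (b * F x) - Real.exp (b * G x)), Real.exp_pos (b * F x),
    Real.exp_pos (b * G x), mul_pos (Real.exp_pos (b * F x)) (Real.exp_pos (b * G x))]

lemma ExpIntegrable.const_mul (hF : ExpIntegrable μ F) (r : ℝ) :
    ExpIntegrable μ (fun x => r * F x) := fun b => by
  simpa only [mul_assoc] using hF (b * r)

lemma ExpIntegrable.neg (hF : ExpIntegrable μ F) : ExpIntegrable μ (fun x => -F x) := by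
  simpa using hF.const_mul (-1)

lemma ExpIntegrable.sub (hF : ExpIntegrable μ F) (hG : ExpIntegrable μ G) :
    ExpIntegrable μ (fun x => F x - G x) := by
  simpa only [sub_eq_add_neg] using hF.add hG.neg

lemma expIntegrable_const [IsFiniteMeasure μ] (r : ℝ) : ExpIntegrable μ (fun _ => r) :=
  fun _ => integrable_const _

lemma ExpIntegrable.sq_mul_exp_abs (hF : ExpIntegrable μ F) (b : ℝ) :
    Integrable (fun x => F x ^ 2 * Real.exp (b * |F x|)) μ := by
  refine (hF.exp_abs (b + 2)).mono' ((hF.aemeasurable.pow_const 2).mul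
    (hF.aemeasurable.abs.const_mul b).exp).aestronglyMeasurable (ae_of_all _ fun x => ?_)
  rw [Real.norm_of_nonneg (by positivity), show (b + 2) * |F x| = |F x| + |F x| + b * |F x| by ring,
    Real.exp_add, Real.exp_add, ← sq_abs, sq]
  have h : |F x| ≤ Real.exp |F x| := by linarith [Real.add_one_le_exp |F x|]
  gcongr

lemma ExpIntegrable.tilted (hF : ExpIntegrable μ F) (hG : ExpIntegrable μ G) (a : ℝ) :
    ExpIntegrable (μ.tilted (fun x => a * G x)) F := fun b => by
  rw [integrable_tilted_iff (hG a)]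
  have := ((hG.const_mul a).add (hF.const_mul b)) 1
  simpa only [one_mul, smul_eq_mul, Real.exp_add] using this

end ExpIntegrable

/-! ### Exponential utility and risk sharing -/

section ExpUtility

variable {α : Type*} [MeasurableSpace α] {μ : Measure α} [IsProbabilityMeasure μ] {F G V R : α → ℝ}

lemma expUtility_map {β : Type*} [MeasurableSpace β] {ν : Measure α} {X : α → β} {f : β → ℝ}
    (a : ℝ) (hX : AEMeasurable X ν) (hf : AEMeasurable f (ν.map X)) :
    expUtility a (ν.map X) f = expUtility a ν (fun x => f (X x)) := by
  unfold expUtility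
  rw [integral_map hX hf.aestronglyMeasurable,
    integral_map hX (hf.const_mul (-a)).exp.aestronglyMeasurable]

lemma expUtility_congr {ν : Measure α} (a : ℝ) (h : F =ᵐ[ν] G) :
    expUtility a ν F = expUtility a ν G := by
  unfold expUtility
  have h' : (fun x => Real.exp (-a * F x)) =ᵐ[ν] fun x => Real.exp (-a * G x) :=
    h.mono fun x hx => by simp only [hx]
  rw [integral_congr_ae h, integral_congr_ae h']

lemma expUtility_dirac [MeasurableSingletonClass α] (a : ℝ) (x : α) (F : α → ℝ) :
    expUtility a (Measure.dirac x) F = F x := by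
  unfold expUtility
  split_ifs with h
  · simp
  · rw [integral_dirac, Real.log_exp]; field_simp

lemma expUtility_add_const (a q : ℝ) (hF : ExpIntegrable μ F) :
    expUtility a μ (fun x => F x + q) = expUtility a μ F + q := by
  unfold expUtility
  split_ifs with h
  · rw [integral_add hF.integrable (integrable_const _)]; simp
  · simp_rw [mul_add, Real.exp_add]
    rw [integral_mul_const, Real.log_mul (integral_exp_pos (hF (-a))).ne' (Real.exp_pos _).ne',
      Real.log_exp]
    field_simp
    ring

lemma expUtility_mono {a : ℝ} (ha : 0 ≤ a) (hF : ExpIntegrable μ F) (hG : ExpIntegrable μ G)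
    (h : ∀ x, F x ≤ G x) : expUtility a μ F ≤ expUtility a μ G := by
  unfold expUtility
  split_ifs with h0
  · exact integral_mono hF.integrable hG.integrable h
  · have h1 : ∫ x, Real.exp (-a * G x) ∂μ ≤ ∫ x, Real.exp (-a * F x) ∂μ :=
      integral_mono (hG _) (hF _) fun x => Real.exp_le_exp.2 (by nlinarith [h x])
    have h2 := Real.log_le_log (integral_exp_pos (hG (-a))) h1
    have h3 : 0 ≤ 1 / a := by positivity
    nlinarith

lemma expUtility_le_add_of_le {a q : ℝ} (ha : 0 ≤ a) (hF : ExpIntegrable μ F)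
    (hG : ExpIntegrable μ G) (h : ∀ x, F x ≤ G x + q) :
    expUtility a μ F ≤ expUtility a μ G + q := by
  rw [← expUtility_add_const a q hG]
  exact expUtility_mono ha hF (hG.add (expIntegrable_const q)) h

/-- Separation of a cash-flow `θ V + R` by an exponential change of measure. -/
lemma expUtility_tilted {a b θ : ℝ} (hab : b * θ = a) (hθ : b ≠ 0 → a = 0 → θ = 0)
    (hV : ExpIntegrable μ V) (hR : ExpIntegrable μ R) :
    expUtility b μ (fun x => θ * V x + R x) =
      θ * expUtility a μ V + expUtility b (μ.tilted fun x => -a * V x) R := by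
  by_cases hb : b = 0
  · obtain rfl : a = 0 := by rw [← hab, hb, zero_mul]
    simp only [expUtility, hb, if_true, neg_zero, zero_mul, tilted_const]
    rw [integral_add (hV.integrable.const_mul _) hR.integrable, integral_const_mul]
  have key : ∫ x, Real.exp (-b * (θ * V x + R x)) ∂μ = (∫ x, Real.exp (-a * V x) ∂μ) *
      ∫ x, Real.exp (-b * R x) ∂(μ.tilted fun x => -a * V x) := by
    rw [integral_exp_tilted, mul_div_cancel₀ _ (integral_exp_pos (hV (-a))).ne']
    congr 1 with x
    rw [← hab]
    simp only [Pi.add_apply]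
    ring_nf
  have hpos : 0 < ∫ x, Real.exp (-b * R x) ∂(μ.tilted fun x => -a * V x) := by
    have := isProbabilityMeasure_tilted (hV (-a))
    exact integral_exp_pos ((hR.tilted hV (-a)) (-b))
  have hl := Real.log_mul (integral_exp_pos (hV (-a))).ne' hpos.ne'
  rw [← key] at hl
  by_cases ha : a = 0
  · have h0 := hθ hb ha
    subst ha
    simp only [expUtility, hb, if_false, h0, zero_mul, zero_add, neg_zero, tilted_const]
  · simp only [expUtility, hb, ha, if_false, hl]
    have : θ = a / b := by field_simp; linarith
    rw [this]
    field_simp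
    ring

/-- Jensen's inequality, from the tangent line of the exponential at `-b m`, where `m` is the mean
of `R`. -/
lemma expUtility_le_integral {b : ℝ} (hb : 0 ≤ b) (hR : ExpIntegrable μ R) :
    expUtility b μ R ≤ ∫ x, R x ∂μ := by
  unfold expUtility
  split_ifs with h
  · exact le_rfl
  have hb' : 0 < b := lt_of_le_of_ne hb (Ne.symm h)
  set m := ∫ x, R x ∂μ with hm
  have hs : Integrable (fun x => -b * (R x - m)) μ :=
    (hR.integrable.sub (integrable_const m)).const_mul _
  have hi : ∫ x, Real.exp (-b * m) * (1 + (-b) * (R x - m)) ∂μ ≤ ∫ x, Real.exp (-b * R x) ∂μ := by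
    refine integral_mono ?_ (hR _) fun x => ?_
    · exact ((integrable_const _).add hs).const_mul _
    · rw [show -b * R x = -b * m + -b * (R x - m) by ring, Real.exp_add]
      gcongr
      linarith [Real.add_one_le_exp (-b * (R x - m))]
  rw [integral_const_mul, integral_add (integrable_const _) hs, integral_const_mul,
    integral_sub hR.integrable (integrable_const _)] at hi
  simp only [integral_const, probReal_univ, one_smul, ← hm, sub_self, mul_zero, add_zero,
    mul_one] at hi
  have hl := Real.log_le_log (Real.exp_pos _) hi
  rw [Real.log_exp] at hl
  rw [neg_mul, neg_le, ← sub_nonneg]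
  have : 1 / b * Real.log (∫ x, Real.exp (-b * R x) ∂μ) - -m =
    1 / b * (Real.log (∫ x, Real.exp (-b * R x) ∂μ) - -b * m) := by field_simp
  rw [this]
  exact mul_nonneg (by positivity) (by linarith)

lemma exp_le_one_add_add_sq_mul_exp (x : ℝ) : Real.exp x ≤ 1 + x + x ^ 2 * Real.exp |x| := by
  have h := Complex.norm_exp_sub_sum_le_norm_mul_exp (x : ℂ) 2
  simp only [Finset.sum_range_succ, Finset.range_zero, Finset.sum_empty] at h
  rw [← Complex.ofReal_exp] at h
  norm_num at h
  norm_cast at h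
  linarith [(abs_le.1 h).2]

/-- The risk premium is of second order: combine `exp x ≤ 1 + x + x² exp |x|` with `log y ≤ y - 1`.
This produces the quadratic loss in `le_sharing`. -/
lemma integral_sub_le_expUtility {b : ℝ} (hb : 0 ≤ b) (hR : ExpIntegrable μ R) :
    ∫ x, R x ∂μ - b * ∫ x, R x ^ 2 * Real.exp (b * |R x|) ∂μ ≤ expUtility b μ R := by
  unfold expUtility
  split_ifs with h
  · simp [h]
  have hb' : 0 < b := lt_of_le_of_ne hb (Ne.symm h)
  have hs : Integrable (fun x => 1 + -b * R x) μ :=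
    (integrable_const _).add (hR.integrable.const_mul _)
  have h1 : ∫ x, Real.exp (-b * R x) ∂μ ≤
      ∫ x, (1 + (-b) * R x + b ^ 2 * (R x ^ 2 * Real.exp (b * |R x|))) ∂μ := by
    refine integral_mono (hR _) (hs.add
      ((hR.sq_mul_exp_abs b).const_mul _)) fun x => ?_
    have := exp_le_one_add_add_sq_mul_exp (-b * R x)
    rw [abs_mul, abs_neg, abs_of_pos hb'] at this
    refine this.trans (le_of_eq ?_)
    ring
  rw [integral_add hs ((hR.sq_mul_exp_abs b).const_mul _), integral_add (integrable_const _)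
      (hR.integrable.const_mul _), integral_const_mul, integral_const_mul] at h1
  simp only [integral_const, probReal_univ, one_smul] at h1
  have h2 := Real.log_le_sub_one_of_pos (integral_exp_pos (hR (-b)))
  rw [← sub_nonneg]
  set L := Real.log (∫ x, Real.exp (-b * R x) ∂μ)
  set J := ∫ x, R x ^ 2 * Real.exp (b * |R x|) ∂μ
  set m := ∫ x, R x ∂μ
  have : -(1 / b) * L - (m - b * J) = 1 / b * (-b * m + b ^ 2 * J - L) := by field_simp; ring
  rw [this]
  exact mul_nonneg (by positivity) (by linarith)

variable {γ c : ℝ}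

/-- With fractions `c/(c+γ)` and `γ/(c+γ)` of `V`, both agents have the same effective risk aversion
`cγ/(c+γ)` towards `V`. So `expUtility_tilted` produces the same tilted measure twice, and the
fractions add up to one. -/
lemma sharing_identity (hcγ : 0 < c + γ) (hV : ExpIntegrable μ V) (hR : ExpIntegrable μ R) :
    expUtility γ μ (fun x => c / (c + γ) * V x + R x) +
      expUtility c μ (fun x => V x - (c / (c + γ) * V x + R x)) =
    expUtility (c * γ / (c + γ)) μ V +
      (expUtility γ (μ.tilted fun x => -(c * γ / (c + γ)) * V x) R +
       expUtility c (μ.tilted fun x => -(c * γ / (c + γ)) * V x) (fun x => -R x)) := by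
  have h1 := expUtility_tilted (a := c * γ / (c + γ)) (b := γ) (θ := c / (c + γ)) (by ring)
    (fun h h' => by
      have : c * γ = 0 := by simpa [hcγ.ne'] using h'
      simp [(mul_eq_zero.1 this).resolve_right h]) hV hR
  have h2 := expUtility_tilted (a := c * γ / (c + γ)) (b := c) (θ := γ / (c + γ)) (by ring)
    (fun h h' => by
      have : c * γ = 0 := by simpa [hcγ.ne'] using h'
      simp [(mul_eq_zero.1 this).resolve_left h]) hV hR.neg
  have h3 : (fun x => V x - (c / (c + γ) * V x + R x)) = fun x => γ / (c + γ) * V x + -R x := by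
    funext x; field_simp; ring
  rw [h3, h1, h2]
  have h4 : γ / (c + γ) = 1 - c / (c + γ) := by field_simp; ring
  rw [h4]; ring

/-- The exponential utility with the harmonic risk aversion bounds the aggregate utility of every
allocation. -/
lemma sharing_le (hγ : 0 ≤ γ) (hc : 0 ≤ c) (hcγ : 0 < c + γ) (hV : ExpIntegrable μ V)
    (hF : ExpIntegrable μ F) :
    expUtility γ μ F + expUtility c μ (fun x => V x - F x) ≤
      expUtility (c * γ / (c + γ)) μ V := by
  have hR : ExpIntegrable μ (fun x => F x - c / (c + γ) * V x) := hF.sub (hV.const_mul _)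
  have h := sharing_identity hcγ hV hR
  simp only [add_sub_cancel] at h
  rw [h]
  have := isProbabilityMeasure_tilted (hV (-(c * γ / (c + γ))))
  have hR' := hR.tilted hV (-(c * γ / (c + γ)))
  have h1 := expUtility_le_integral hγ hR'
  have h2 := expUtility_le_integral hc hR'.neg
  rw [integral_neg] at h2
  linarith

/-- Near-optimality of an allocation close to the linear one. The constant `r` is a cash transfer
between the agents and cancels, so only the centred residual `R` is charged. -/
lemma le_sharing (hγ : 0 ≤ γ) (hc : 0 ≤ c) (hcγ : 0 < c + γ) (hV : ExpIntegrable μ V)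
    (hF : ExpIntegrable μ F) (r : ℝ) (hR : ∀ x, F x - c / (c + γ) * V x - r = R x) :
    expUtility (c * γ / (c + γ)) μ V - (γ + c) *
        ∫ x, R x ^ 2 * Real.exp ((γ + c) * |R x|) ∂(μ.tilted fun x => -(c * γ / (c + γ)) * V x) ≤
      expUtility γ μ F + expUtility c μ (fun x => V x - F x) := by
  obtain rfl : (fun x => F x - c / (c + γ) * V x - r) = R := funext hR
  have hR : ExpIntegrable μ (fun x => F x - c / (c + γ) * V x - r) :=
    (hF.sub (hV.const_mul _)).sub (expIntegrable_const r)
  have h := sharing_identity hcγ hV hR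
  have e1 := expUtility_add_const γ (-r) hF
  have e2 := expUtility_add_const c r (hV.sub hF)
  rw [show (fun x => c / (c + γ) * V x + (F x - c / (c + γ) * V x - r)) = fun x => F x + -r by
    funext x; ring, show (fun x => V x - (c / (c + γ) * V x + (F x - c / (c + γ) * V x - r))) =
    fun x => V x - F x + r by funext x; ring, e1, e2] at h
  set R := fun x => F x - c / (c + γ) * V x - r
  have := isProbabilityMeasure_tilted (hV (-(c * γ / (c + γ))))
  have hR' := hR.tilted hV (-(c * γ / (c + γ)))
  have h1 := integral_sub_le_expUtility hγ hR'
  have h2 := integral_sub_le_expUtility hc hR'.neg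
  rw [integral_neg] at h2
  simp only [neg_sq, abs_neg] at h2
  have m1 : ∀ b, b ≤ γ + c → ∫ x, R x ^ 2 * Real.exp (b * |R x|)
        ∂(μ.tilted fun x => -(c * γ / (c + γ)) * V x) ≤ ∫ x, R x ^ 2 * Real.exp ((γ + c) * |R x|)
        ∂(μ.tilted fun x => -(c * γ / (c + γ)) * V x) := fun b hb =>
    integral_mono (hR'.sq_mul_exp_abs _) (hR'.sq_mul_exp_abs _) fun x => by
      dsimp only
      gcongr
  have n1 := mul_le_mul_of_nonneg_left (m1 γ (by linarith)) hγ
  have n2 := mul_le_mul_of_nonneg_left (m1 c (by linarith)) hc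
  linarith

end ExpUtility

end IndifferencePricing

namespace IndifferencePricing

/-! ### Gaussian kernels and their tilts -/

section Gaussian

variable {k : ℕ}

instance isProbabilityMeasure_brownianKernel (r : ℝ) (w : E k) :
    IsProbabilityMeasure (brownianKernel r w) :=
  Measure.isProbabilityMeasure_map (by fun_prop)

lemma brownianKernel_zero (w : E k) : brownianKernel 0 w = Measure.dirac w := by
  simp [brownianKernel, Measure.map_const]

lemma map_const_add_brownianKernel (r : ℝ) (w x : E k) :
    (brownianKernel r x).map (fun y => w + y) = brownianKernel r (w + x) := by
  rw [brownianKernel, Measure.map_map (by fun_prop) (by fun_prop)]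
  simp only [Function.comp_def, ← add_assoc]
  rfl

lemma charFun_brownianKernel {r : ℝ} (hr : 0 ≤ r) (w t : E k) :
    charFun (brownianKernel r w) t =
      Complex.exp (-(r * ‖t‖ ^ 2 / 2 : ℝ)) * Complex.exp (inner ℝ w t * Complex.I) := by
  have h : brownianKernel r w =
      ((stdGaussian (E k)).map (fun x => Real.sqrt r • x)).map (fun x => w + x) := by
    rw [Measure.map_map (by fun_prop) (by fun_prop)]; rfl
  rw [h, charFun_map_const_add, charFun_map_smul, charFun_stdGaussian, norm_smul, Real.norm_eq_abs]
  have h2 : -((|Real.sqrt r| * ‖t‖ : ℝ) : ℂ) ^ 2 / 2 = -(r * ‖t‖ ^ 2 / 2 : ℝ) := by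
    norm_cast
    rw [mul_pow, sq_abs, Real.sq_sqrt hr]
    ring
  rw [h2]

lemma brownianKernel_conv {r δ : ℝ} (hr : 0 ≤ r) (hδ : 0 ≤ δ) (w : E k) :
    brownianKernel δ w ∗ brownianKernel r 0 = brownianKernel (δ + r) w := by
  apply Measure.ext_of_charFun
  funext t
  rw [charFun_conv, charFun_brownianKernel hδ, charFun_brownianKernel hr,
    charFun_brownianKernel (add_nonneg hδ hr)]
  simp only [inner_zero_left, Complex.ofReal_zero, zero_mul, Complex.exp_zero, mul_one]
  rw [mul_right_comm, ← Complex.exp_add]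
  congr 2
  push_cast
  ring

lemma integrable_exp_norm_stdGaussian (b : ℝ) :
    Integrable (fun x : E k => Real.exp (b * ‖x‖)) (stdGaussian (E k)) := by
  -- Fernique's theorem; completing the square gives `b‖x‖ ≤ b²/(4C) + C‖x‖²`.
  obtain ⟨C, hC, hint⟩ := IsGaussian.exists_integrable_exp_sq (stdGaussian (E k))
  refine (hint.const_mul (Real.exp (b ^ 2 / (4 * C)))).mono' (by fun_prop)
    (ae_of_all _ fun x => ?_)
  rw [Real.norm_of_nonneg (Real.exp_pos _).le, ← Real.exp_add]
  gcongr
  have h : b ^ 2 / (4 * C) + C * ‖x‖ ^ 2 - b * ‖x‖ = (b - 2 * C * ‖x‖) ^ 2 / (4 * C) := by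
    field_simp; ring
  have : 0 ≤ (b - 2 * C * ‖x‖) ^ 2 / (4 * C) := by positivity
  linarith

/-- Lipschitz functions grow at most linearly. Every integrability claim about `v`, `p` and the
scheme rests on this. -/
lemma _root_.LipschitzWith.expIntegrable_brownianKernel {f : E k → ℝ} {L : NNReal}
    (hf : LipschitzWith L f) (r : ℝ) (w : E k) : ExpIntegrable (brownianKernel r w) f := fun b => by
  have hc := hf.continuous
  rw [brownianKernel, integrable_map_measure (by fun_prop) (by fun_prop)]
  refine ((integrable_exp_norm_stdGaussian (|b| * (L * Real.sqrt r))).const_mul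
    (Real.exp (b * f w))).mono' (by fun_prop) (ae_of_all _ fun x => ?_)
  rw [Function.comp_apply, Real.norm_of_nonneg (Real.exp_pos _).le, ← Real.exp_add]
  gcongr
  have h1 := hf.dist_le_mul (w + Real.sqrt r • x) w
  rw [dist_eq_norm, dist_eq_norm, add_sub_cancel_left, norm_smul, Real.norm_eq_abs,
    Real.norm_eq_abs, abs_of_nonneg (Real.sqrt_nonneg r)] at h1
  have h2 := le_abs_self (b * (f (w + Real.sqrt r • x) - f w))
  rw [abs_mul] at h2
  have h3 := mul_le_mul_of_nonneg_left h1 (abs_nonneg b)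
  nlinarith

lemma expUtility_brownianKernel {f : E k → ℝ} (hf : Measurable f) (a r : ℝ) (w : E k) :
    expUtility a (brownianKernel r w) f = expUtility a (brownianKernel r 0) (fun x => f (w + x)) := by
  rw [← add_zero w, ← map_const_add_brownianKernel, add_zero,
    expUtility_map a (by fun_prop) hf.aemeasurable]

lemma integral_brownianKernel_add {f : E k → ℝ} (hf : Measurable f) {r δ : ℝ} (hr : 0 ≤ r)
    (hδ : 0 ≤ δ) (w : E k) (hi : Integrable f (brownianKernel (δ + r) w)) :
    ∫ x, ∫ y, f y ∂(brownianKernel r x) ∂(brownianKernel δ w) =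
      ∫ y, f y ∂(brownianKernel (δ + r) w) := by
  rw [← brownianKernel_conv hr hδ] at hi ⊢
  rw [integral_conv hi]
  congr 1 with x
  nth_rw 1 [← add_zero x]
  rw [← map_const_add_brownianKernel,
    integral_map (by fun_prop) hf.aestronglyMeasurable]

/-- Time consistency of the exponential utility under the heat semigroup. -/
lemma expUtility_brownianKernel_add {f : E k → ℝ} {L : NNReal} (hf : LipschitzWith L f) (a : ℝ)
    {r δ : ℝ} (hr : 0 ≤ r) (hδ : 0 ≤ δ) (w : E k) :
    expUtility a (brownianKernel δ w) (fun x => expUtility a (brownianKernel r x) f) =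
      expUtility a (brownianKernel (δ + r) w) f := by
  have hm : Measurable f := hf.continuous.measurable
  by_cases ha : a = 0
  · simp only [expUtility, ha, if_true]
    exact integral_brownianKernel_add hm hr hδ w (hf.expIntegrable_brownianKernel _ w).integrable
  · simp only [expUtility, ha, if_false]
    rw [← integral_brownianKernel_add (hm.const_mul (-a)).exp hr hδ w
      (hf.expIntegrable_brownianKernel _ w (-a))]
    congr 2
    congr 1 with x
    rw [← mul_assoc, show -a * -(1 / a) = 1 by field_simp, one_mul,
      Real.exp_log (integral_exp_pos (hf.expIntegrable_brownianKernel r x (-a)))]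

/-- Moving the starting point translates `f`, which changes it by at most `L` times the distance;
monotonicity and cash invariance keep the constant. -/
lemma _root_.LipschitzWith.expUtility_brownianKernel {f : E k → ℝ} {L : NNReal}
    (hf : LipschitzWith L f) {a : ℝ} (ha : 0 ≤ a) (r : ℝ) :
    LipschitzWith L (fun w => expUtility a (brownianKernel r w) f) := by
  have hm : Measurable f := hf.continuous.measurable
  refine LipschitzWith.of_le_add_mul L fun w w' => ?_
  have hl : ∀ w : E k, LipschitzWith L (fun x => f (w + x)) := fun w =>
    LipschitzWith.of_dist_le_mul fun x y => by
      simpa using hf.dist_le_mul (w + x) (w + y)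
  rw [IndifferencePricing.expUtility_brownianKernel hm a r w,
    IndifferencePricing.expUtility_brownianKernel hm a r w']
  refine expUtility_le_add_of_le ha ((hl w).expIntegrable_brownianKernel _ _)
    ((hl w').expIntegrable_brownianKernel _ _) fun x => ?_
  have := hf.dist_le_mul (w + x) (w' + x)
  rw [dist_add_right, Real.dist_eq] at this
  linarith [(abs_le.1 this).2]

/-- Second order bound for a remainder with small gradient at `w`, uniformly over Lipschitz tilts. -/
lemma exists_integral_tilted_brownianKernel_le (k : ℕ) (a b : ℝ) (ha : 0 ≤ a) (hb : 0 ≤ b)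
    (L M : NNReal) :
    ∃ K : ℝ, 0 ≤ K ∧ ∀ (δ : ℝ) (w : E k) (V R : E k → ℝ) (ε B : ℝ), 0 ≤ δ → δ ≤ 1 →
      LipschitzWith L V → LipschitzWith M R → R w = 0 → 0 ≤ ε → 0 ≤ B →
      (∀ x, |R x| ≤ (ε + B * ‖x - w‖) * ‖x - w‖) →
      ∫ x, R x ^ 2 * Real.exp (b * |R x|) ∂((brownianKernel δ w).tilted fun x => -a * V x) ≤
        K * δ * (ε + B * Real.sqrt δ) ^ 2 := by
  set ν := stdGaussian (E k)
  -- Up to the factor `exp (-a V w)`, a lower bound for the normalising constant of the tilt.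
  set κ₀ := ∫ x : E k, Real.exp (-(a * L) * ‖x‖) ∂ν
  have hκ₀ : 0 < κ₀ := integral_exp_pos (integrable_exp_norm_stdGaussian _)
  -- The growth rates of the tilting density, of `exp (b|R|)`, and of `R²`, where `((1 + ‖x‖)‖x‖)² ≤
  -- exp (4‖x‖)`. Since `√δ ≤ 1`, none depends on `δ`.
  set m := a * L + b * M + 4
  set K₁ := ∫ x : E k, Real.exp (m * ‖x‖) ∂ν
  refine ⟨K₁ / κ₀, div_nonneg (integral_nonneg fun x => (Real.exp_pos _).le) hκ₀.le, ?_⟩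
  intro δ w V R ε B hδ hδ1 hV hR hRw hε hB hbd
  have hs1 : Real.sqrt δ ≤ 1 := Real.sqrt_le_one.2 hδ1
  have hs0 := Real.sqrt_nonneg δ
  have hVc := hV.continuous
  have hRc := hR.continuous
  have hn : ∀ x : E k, ‖w + Real.sqrt δ • x - w‖ = Real.sqrt δ * ‖x‖ := fun x => by
    rw [add_sub_cancel_left, norm_smul, Real.norm_eq_abs, abs_of_nonneg hs0]
  have hVb : ∀ x : E k, |V (w + Real.sqrt δ • x) - V w| ≤ L * ‖x‖ := fun x => by
    have h1 := hV.dist_le_mul (w + Real.sqrt δ • x) w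
    rw [Real.dist_eq, dist_eq_norm, hn] at h1
    refine h1.trans ?_
    gcongr
    nlinarith [norm_nonneg x]
  have hRb : ∀ x : E k, |R (w + Real.sqrt δ • x)| ≤ M * ‖x‖ := fun x => by
    have h1 := hR.dist_le_mul (w + Real.sqrt δ • x) w
    rw [Real.dist_eq, dist_eq_norm, hn, hRw, sub_zero] at h1
    refine h1.trans ?_
    gcongr
    nlinarith [norm_nonneg x]
  have hVint := hV.expIntegrable_brownianKernel δ w (-a)
  set Z := ∫ x, Real.exp (-a * V x) ∂(brownianKernel δ w) with hZ
  have hZpos : 0 < Z := integral_exp_pos hVint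
  have hZle : Real.exp (-a * V w) * κ₀ ≤ Z := by
    rw [hZ, brownianKernel, integral_map (by fun_prop) (by fun_prop), ← integral_const_mul]
    rw [brownianKernel, integrable_map_measure (by fun_prop) (by fun_prop)] at hVint
    refine integral_mono ((integrable_exp_norm_stdGaussian _).const_mul _) hVint fun x => ?_
    dsimp only [Function.comp_apply]
    rw [← Real.exp_add]
    gcongr
    have := mul_le_mul_of_nonneg_left (abs_le.1 (hVb x)).2 ha
    nlinarith
  rw [integral_tilted, brownianKernel, integral_map (by fun_prop) (by fun_prop)]
  have hfin : ∫ x : E k, Real.exp (m * ‖x‖) / κ₀ * (δ * (ε + B * Real.sqrt δ) ^ 2) ∂ν =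
      K₁ / κ₀ * δ * (ε + B * Real.sqrt δ) ^ 2 := by
    rw [integral_mul_const, integral_div]; ring
  rw [← hfin]
  refine integral_mono_of_nonneg (ae_of_all _ fun x => ?_)
    (((integrable_exp_norm_stdGaussian _).div_const _).mul_const _) (ae_of_all _ fun x => ?_)
  · simp only [Pi.zero_apply, smul_eq_mul]; positivity
  · rw [← brownianKernel, ← hZ]
    dsimp only
    rw [smul_eq_mul]
    have hx := norm_nonneg x
    have e1 : Real.exp (-a * V (w + Real.sqrt δ • x)) / Z ≤ Real.exp (a * L * ‖x‖) / κ₀ := by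
      rw [div_le_div_iff₀ hZpos hκ₀]
      calc Real.exp (-a * V (w + Real.sqrt δ • x)) * κ₀
          ≤ Real.exp (a * L * ‖x‖) * Real.exp (-a * V w) * κ₀ := by
            rw [← Real.exp_add]
            gcongr
            have := mul_le_mul_of_nonneg_left (abs_le.1 (hVb x)).1 ha
            nlinarith
        _ ≤ _ := by rw [mul_assoc]; gcongr
    have e2 : Real.exp (b * |R (w + Real.sqrt δ • x)|) ≤ Real.exp (b * M * ‖x‖) := by
      rw [mul_assoc]
      gcongr
      exact hRb x
    have e3 : |R (w + Real.sqrt δ • x)| ≤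
        Real.sqrt δ * (ε + B * Real.sqrt δ) * Real.exp (2 * ‖x‖) := by
      have h1 := hbd (w + Real.sqrt δ • x)
      rw [hn] at h1
      have h2 : 1 + ‖x‖ ≤ Real.exp ‖x‖ := by linarith [Real.add_one_le_exp ‖x‖]
      have h3 : (1 + ‖x‖) * ‖x‖ ≤ Real.exp (2 * ‖x‖) := by
        rw [two_mul, Real.exp_add]
        gcongr
        linarith
      have h4 : (ε + B * (Real.sqrt δ * ‖x‖)) ≤ (ε + B * Real.sqrt δ) * (1 + ‖x‖) := by
        have : 0 ≤ ε * ‖x‖ + B * Real.sqrt δ := by positivity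
        nlinarith
      calc _ ≤ _ := h1
        _ ≤ (ε + B * Real.sqrt δ) * (1 + ‖x‖) * (Real.sqrt δ * ‖x‖) := by gcongr
        _ = Real.sqrt δ * (ε + B * Real.sqrt δ) * ((1 + ‖x‖) * ‖x‖) := by ring
        _ ≤ _ := by gcongr
    have e4 : R (w + Real.sqrt δ • x) ^ 2 ≤
        δ * (ε + B * Real.sqrt δ) ^ 2 * Real.exp (4 * ‖x‖) := by
      rw [← sq_abs]
      calc _ ≤ (Real.sqrt δ * (ε + B * Real.sqrt δ) * Real.exp (2 * ‖x‖)) ^ 2 := by gcongr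
        _ = _ := by
          rw [mul_pow, mul_pow, Real.sq_sqrt hδ, ← Real.exp_nat_mul]
          push_cast
          ring_nf
    calc _ ≤ Real.exp (a * L * ‖x‖) / κ₀ *
          (δ * (ε + B * Real.sqrt δ) ^ 2 * Real.exp (4 * ‖x‖) * Real.exp (b * M * ‖x‖)) := by
          gcongr
      _ = _ := by
        rw [show m * ‖x‖ = a * L * ‖x‖ + 4 * ‖x‖ + b * M * ‖x‖ by simp only [m]; ring,
          Real.exp_add, Real.exp_add]
        ring

end Gaussian

end IndifferencePricing

noncomputable section

namespace IndifferencePricing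

/-! ### Consequences of the derivative bounds -/

section Regularity

variable {k : ℕ} {Y : Type*} [PseudoMetricSpace Y] {B : Set Y} {f : ℝ → E k → Y → ℝ}

lemma norm_fderiv_eq_norm_gradient (φ : E k → ℝ) (w : E k) :
    ‖fderiv ℝ φ w‖ = ‖gradient φ w‖ := by
  rw [gradient, LinearIsometryEquiv.norm_map]

lemma HasRegularDerivs.exists_lipschitzWith (hf : HasRegularDerivs B f) :
    ∃ L : NNReal, ∀ t ∈ Icc (0 : ℝ) 1, ∀ y ∈ B, LipschitzWith L (fun w => f t w y) := by
  obtain ⟨C, hC⟩ := hf.bounded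
  refine ⟨C.toNNReal, fun t ht y hy => lipschitzWith_of_nnnorm_fderiv_le (𝕜 := ℝ)
    ((hf.contDiff_space t ht y hy).differentiable (by norm_num)) fun w => ?_⟩
  rw [← NNReal.coe_le_coe, coe_nnnorm, norm_fderiv_eq_norm_gradient]
  exact (hC t ht w y hy).2.1.trans (Real.le_coe_toNNReal C)

lemma HasRegularDerivs.exists_lipschitzWith_gradient (hf : HasRegularDerivs B f) :
    ∃ L : NNReal, ∀ t ∈ Icc (0 : ℝ) 1, ∀ y ∈ B, LipschitzWith L (gradient fun w => f t w y) := by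
  obtain ⟨C, hC⟩ := hf.bounded
  refine ⟨C.toNNReal, fun t ht y hy => lipschitzWith_of_nnnorm_fderiv_le (𝕜 := ℝ) ?_ fun w => ?_⟩
  · have h1 : ContDiff ℝ 1 (fderiv ℝ fun w => f t w y) :=
      (hf.contDiff_space t ht y hy).fderiv_right (by norm_num)
    exact (InnerProductSpace.toDual ℝ (E k)).symm.differentiable.comp
      (h1.differentiable (by norm_num))
  · rw [← NNReal.coe_le_coe, coe_nnnorm]
    exact (hC t ht w y hy).2.2.trans (Real.le_coe_toNNReal C)

lemma HasRegularDerivs.gradient_uniform_time (hf : HasRegularDerivs B f) {ε : ℝ} (hε : 0 < ε) :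
    ∃ η > 0, ∀ t ∈ Icc (0 : ℝ) 1, ∀ t' ∈ Icc (0 : ℝ) 1, |t' - t| < η → ∀ w : E k, ∀ y ∈ B,
      ‖gradient (fun w' => f t' w' y) w - gradient (fun w' => f t w' y) w‖ ≤ ε := by
  obtain ⟨η, hη, h⟩ := Metric.uniformContinuousOn_iff.1 hf.uniform_gradient ε hε
  refine ⟨η, hη, fun t ht t' ht' htt w y hy => ?_⟩
  have := h (t', w, y) ⟨ht', mem_univ _, hy⟩ (t, w, y) ⟨ht, mem_univ _, hy⟩
    (by simpa [Prod.dist_eq, Real.dist_eq, hη] using htt)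
  rw [dist_eq_norm] at this
  exact this.le

end Regularity

lemma gradient_sub_const_mul {k : ℕ} {φ ψ : E k → ℝ} {x : E k} (hφ : DifferentiableAt ℝ φ x)
    (hψ : DifferentiableAt ℝ ψ x) (θ : ℝ) :
    gradient (fun w => φ w - θ * ψ w) x = gradient φ x - θ • gradient ψ x := by
  unfold gradient
  rw [fderiv_fun_sub hφ (hψ.const_mul θ), fderiv_const_mul hψ, map_sub, map_smul]

/-- Mean value inequality on the closed ball about `w` of radius `‖x - w‖`. -/
lemma abs_sub_le_of_gradient_le {k : ℕ} {φ : E k → ℝ} (hφ : Differentiable ℝ φ) {w : E k}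
    {ε B : ℝ} (hB : 0 ≤ B) (h : ∀ x, ‖gradient φ x‖ ≤ ε + B * ‖x - w‖) (x : E k) :
    |φ x - φ w| ≤ (ε + B * ‖x - w‖) * ‖x - w‖ := by
  rw [← Real.norm_eq_abs]
  refine (convex_closedBall w ‖x - w‖).norm_image_sub_le_of_norm_fderiv_le (𝕜 := ℝ)
    (fun y _ => hφ y) (fun y hy => ?_) (by simp) (by simp [dist_eq_norm])
  rw [norm_fderiv_eq_norm_gradient]
  rw [mem_closedBall_iff_norm] at hy
  exact (h y).trans (by gcongr)

/-! ### The Markovian scheme and its limit -/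

section Scheme

variable {k d : ℕ} {γ c : ℝ} {s : E k → E d} {g h : E k → ℝ} {A : Set (E d)}

lemma vFun_one (γ c : ℝ) (g h : E k → ℝ) : vFun γ c g h 1 = fun w => g w + h w := by
  funext w
  rw [vFun, sub_self, brownianKernel_zero, expUtility_dirac]

lemma pFun_one (γ : ℝ) (g : E k → ℝ) (s : E k → E d) (w : E k) (y : E d) :
    pFun γ g s 1 w y = g w - inner ℝ y (s w) := by
  rw [pFun, sub_self, brownianKernel_zero, expUtility_dirac]

lemma one_mem_unitInterval : (1 : ℝ) ∈ Icc (0 : ℝ) 1 := ⟨zero_le_one, le_rfl⟩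

/-- The gradient bound at `t = 1`, where the kernel is a Dirac mass, makes `g + h` Lipschitz, so the
semigroup property applies. -/
lemma vFun_step (hv : HasRegularDerivs (Set.univ : Set Unit) (fun t w _ => vFun γ c g h t w))
    {t δ : ℝ} (hδ : 0 ≤ δ) (ht1 : t + δ ≤ 1) (w : E k) :
    expUtility (c * γ / (c + γ)) (brownianKernel δ w) (vFun γ c g h (t + δ)) =
      vFun γ c g h t w := by
  obtain ⟨L, hL⟩ := hv.exists_lipschitzWith
  have hl := hL 1 one_mem_unitInterval () (mem_univ _)
  simp only [vFun_one] at hl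
  have := expUtility_brownianKernel_add hl (c * γ / (c + γ)) (r := 1 - (t + δ)) (δ := δ)
    (by linarith) hδ w
  rw [show δ + (1 - (t + δ)) = 1 - t by ring] at this
  exact this

lemma pFun_step (hp : HasRegularDerivs A (pFun γ g s)) {u : E d} (hu : u ∈ A)
    {t δ : ℝ} (hδ : 0 ≤ δ) (ht1 : t + δ ≤ 1) (w : E k) :
    expUtility γ (brownianKernel δ w) (fun x => pFun γ g s (t + δ) x u) = pFun γ g s t w u := by
  obtain ⟨L, hL⟩ := hp.exists_lipschitzWith
  have hl := hL 1 one_mem_unitInterval u hu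
  simp only [pFun_one] at hl
  have := expUtility_brownianKernel_add hl γ (r := 1 - (t + δ)) (δ := δ) (by linarith) hδ w
  rw [show δ + (1 - (t + δ)) = 1 - t by ring] at this
  exact this

/-- One step of the dynamic programming never exceeds the representative agent's value. -/
lemma step_le (hγ : 0 ≤ γ) (hc : 0 ≤ c) (hcγ : 0 < c + γ)
    (hv : HasRegularDerivs (Set.univ : Set Unit) (fun t w _ => vFun γ c g h t w))
    (hp : HasRegularDerivs A (pFun γ g s)) {u : E d} (hu : u ∈ A)
    {t δ : ℝ} (ht : 0 ≤ t) (hδ : 0 ≤ δ) (ht1 : t + δ ≤ 1) (w : E k) :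
    pFun γ g s t w u + expUtility c (brownianKernel δ w)
      (fun x => vFun γ c g h (t + δ) x - pFun γ g s (t + δ) x u) ≤ vFun γ c g h t w := by
  obtain ⟨L, hL⟩ := hv.exists_lipschitzWith
  obtain ⟨M, hM⟩ := hp.exists_lipschitzWith
  have htδ : t + δ ∈ Icc (0 : ℝ) 1 := ⟨by linarith, ht1⟩
  rw [← pFun_step hp hu hδ ht1, ← vFun_step hv hδ ht1]
  exact sharing_le hγ hc hcγ ((hL _ htδ () (mem_univ _)).expIntegrable_brownianKernel δ w)
    ((hM _ htδ u hu).expIntegrable_brownianKernel δ w)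

/-- At the strategy replicating the optimal allocation, one step of the dynamic programming loses
only `o(δ)`, uniformly in time and space. -/
lemma exists_le_step (hγ : 0 ≤ γ) (hc : 0 ≤ c) (hcγ : 0 < c + γ)
    (hv : HasRegularDerivs (Set.univ : Set Unit) (fun t w _ => vFun γ c g h t w))
    (hp : HasRegularDerivs A (pFun γ g s)) {yd : E k × ℝ × E k → E d}
    (hyd : IsCompletenessMap γ g s yd)
    (hAyd : ∀ t ∈ Icc (0 : ℝ) 1, ∀ w : E k,
      yd (w, t, -((c / (c + γ)) • gradient (vFun γ c g h t) w)) ∈ A) {ε : ℝ} (hε : 0 < ε) :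
    ∃ δ₀ > 0, ∀ t δ : ℝ, 0 ≤ t → 0 ≤ δ → δ < δ₀ → t + δ ≤ 1 → ∀ w : E k, ∃ u ∈ A,
      vFun γ c g h t w - δ * ε ≤ pFun γ g s t w u + expUtility c (brownianKernel δ w)
        (fun x => vFun γ c g h (t + δ) x - pFun γ g s (t + δ) x u) := by
  obtain ⟨L, hL⟩ := hv.exists_lipschitzWith
  obtain ⟨M, hM⟩ := hp.exists_lipschitzWith
  obtain ⟨L', hL'⟩ := hv.exists_lipschitzWith_gradient
  obtain ⟨M', hM'⟩ := hp.exists_lipschitzWith_gradient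
  set θ := c / (c + γ) with hθ
  have hθ0 : 0 ≤ θ := div_nonneg hc hcγ.le
  have ha : 0 ≤ c * γ / (c + γ) := by positivity
  obtain ⟨K, hK0, hK⟩ := exists_integral_tilted_brownianKernel_le k (c * γ / (c + γ)) (γ + c) ha
    (by linarith) L (M + θ.toNNReal * L)
  set B : ℝ := M' + θ * L' with hBdef
  have hB : 0 ≤ B := by positivity
  -- `ρ` will bound both `√δ` and the change of the gradients between `t` and `t + δ`; the loss per
  -- unit of time is then at most this expression at `ρ`.
  have hlim : Tendsto (fun x : ℝ => (γ + c) * K * ((1 + θ) * x + B * x) ^ 2) (𝓝 0) (𝓝 0) := by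
    have : Continuous (fun x : ℝ => (γ + c) * K * ((1 + θ) * x + B * x) ^ 2) := by fun_prop
    simpa using this.tendsto 0
  obtain ⟨ρ, hρ, hρε⟩ : ∃ ρ > 0, (γ + c) * K * ((1 + θ) * ρ + B * ρ) ^ 2 < ε := by
    obtain ⟨r, hr, h⟩ := Metric.eventually_nhds_iff.1 (hlim.eventually_lt_const hε)
    exact ⟨r / 2, by positivity, h (by rw [Real.dist_eq, sub_zero, abs_of_pos] <;> linarith)⟩
  obtain ⟨η₁, hη₁, hv'⟩ := hv.gradient_uniform_time hρ
  obtain ⟨η₂, hη₂, hp'⟩ := hp.gradient_uniform_time hρ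
  refine ⟨min (min η₁ η₂) (ρ ^ 2), by positivity, fun t δ ht hδ hδ₀ ht1 w => ?_⟩
  simp only [lt_min_iff] at hδ₀
  have htI : t ∈ Icc (0 : ℝ) 1 := ⟨ht, by linarith⟩
  have htδ : t + δ ∈ Icc (0 : ℝ) 1 := ⟨by linarith, ht1⟩
  have hsq : Real.sqrt δ ≤ ρ := Real.sqrt_le_iff.2 ⟨hρ.le, hδ₀.2.le⟩
  have habs : |t + δ - t| = δ := by rw [add_sub_cancel_left, abs_of_nonneg hδ]
  set u := yd (w, t, -(θ • gradient (vFun γ c g h t) w)) with hu_def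
  have hu : u ∈ A := hAyd t htI w
  refine ⟨u, hu, ?_⟩
  -- Completeness cancels the gradient of the residual at time `t`; at time `t + δ` it is then at
  -- most `(1 + θ)ρ` at `w`.
  have hgr : gradient (fun w' => pFun γ g s t w' u) w = θ • gradient (vFun γ c g h t) w := by
    have := (hyd.hasGradientAt (-(θ • gradient (vFun γ c g h t) w)) t htI w).gradient
    rwa [neg_neg] at this
  set V := vFun γ c g h (t + δ)
  set F := fun x => pFun γ g s (t + δ) x u
  have hVL : LipschitzWith L V := hL _ htδ () (mem_univ _)
  have hFM : LipschitzWith M F := hM _ htδ u hu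
  have hVd : Differentiable ℝ V :=
    (hv.contDiff_space _ htδ () (mem_univ _)).differentiable (by norm_num)
  have hFd : Differentiable ℝ F := (hp.contDiff_space _ htδ u hu).differentiable (by norm_num)
  set R₀ := fun x => F x - θ * V x
  have hR₀d : Differentiable ℝ R₀ := hFd.sub (hVd.const_mul θ)
  have hR₀g : ∀ x, gradient R₀ x = gradient F x - θ • gradient V x := fun x =>
    gradient_sub_const_mul (hFd x) (hVd x) θ
  have hw : ‖gradient R₀ w‖ ≤ (1 + θ) * ρ := by
    have h1 := hp' t htI _ htδ (by rw [habs]; exact hδ₀.1.2) w u hu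
    have h2 := hv' t htI _ htδ (by rw [habs]; exact hδ₀.1.1) w () (mem_univ _)
    rw [hgr] at h1
    have : gradient R₀ w = (gradient F w - θ • gradient (vFun γ c g h t) w) -
        θ • (gradient V w - gradient (vFun γ c g h t) w) := by
      rw [hR₀g, smul_sub]; abel
    rw [this]
    refine (norm_sub_le _ _).trans ?_
    rw [norm_smul, Real.norm_of_nonneg hθ0]
    have := mul_le_mul_of_nonneg_left h2 hθ0
    linarith
  have hgrad : ∀ x, ‖gradient R₀ x‖ ≤ (1 + θ) * ρ + B * ‖x - w‖ := fun x => by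
    have h1 := (hM' _ htδ u hu).norm_sub_le x w
    have h2 := (hL' _ htδ () (mem_univ _)).norm_sub_le x w
    have : gradient R₀ x = gradient R₀ w + ((gradient F x - gradient F w) -
        θ • (gradient V x - gradient V w)) := by
      rw [hR₀g, hR₀g, smul_sub]; abel
    rw [this]
    refine (norm_add_le _ _).trans (add_le_add hw ((norm_sub_le _ _).trans ?_))
    rw [norm_smul, Real.norm_of_nonneg hθ0]
    have := mul_le_mul_of_nonneg_left h2 hθ0
    rw [hBdef, add_mul, mul_assoc]
    exact add_le_add h1 this
  have hRbd := abs_sub_le_of_gradient_le hR₀d hB hgrad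
  set R := fun x => F x - θ * V x - R₀ w
  have hRL : LipschitzWith (M + θ.toNNReal * L) R := LipschitzWith.of_le_add_mul _ fun x y => by
    have h1 := hFM.dist_le_mul x y
    have h2 := hVL.dist_le_mul x y
    rw [Real.dist_eq] at h1 h2
    have h3 := mul_le_mul_of_nonneg_left (abs_le.1 h2).1 hθ0
    have h4 := (abs_le.1 h1).2
    push_cast
    rw [Real.coe_toNNReal _ hθ0]
    simp only [R]
    nlinarith
  have hI := hK δ w V R ((1 + θ) * ρ) B hδ (by linarith) hVL hRL (by simp [R, R₀])
    (by positivity) hB hRbd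
  have hmain := le_sharing hγ hc hcγ (hVL.expIntegrable_brownianKernel δ w)
    (hFM.expIntegrable_brownianKernel δ w) (R₀ w) (fun x => (rfl : _ = R x))
  rw [vFun_step hv hδ ht1, pFun_step hp hu hδ ht1] at hmain
  refine le_trans ?_ hmain
  have h1 : (γ + c) * (K * δ * ((1 + θ) * ρ + B * Real.sqrt δ) ^ 2) ≤ δ * ε := by
    calc _ ≤ (γ + c) * (K * δ * ((1 + θ) * ρ + B * ρ) ^ 2) := by gcongr
      _ = δ * ((γ + c) * K * ((1 + θ) * ρ + B * ρ) ^ 2) := by ring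
      _ ≤ δ * ε := by gcongr
  have h2 := mul_le_mul_of_nonneg_left hI (by linarith : 0 ≤ γ + c)
  linarith

/-- Value of moving to the position `u` at time `t` when the continuation value at time `t'` is `q`,
with the supplier's utility level added. -/
def schemeStep (γ c : ℝ) (g : E k → ℝ) (s : E k → E d) (t t' δ : ℝ) (q : E k → ℝ) (w : E k)
    (u : E d) : ℝ :=
  pFun γ g s t w u + expUtility c (brownianKernel δ w) (fun x => q x - pFun γ g s t' x u)

/-- The Markovian part of the dynamic programming value with `m` of `n` trading dates left. -/
def schemeValue (γ c : ℝ) (g h : E k → ℝ) (s : E k → E d) (A : Set (E d)) (n : ℕ) :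
    ℕ → E k → ℝ
  | 0, w => g w + h w
  | m + 1, w => sSup (schemeStep γ c g s (((n : ℝ) - ((m : ℝ) + 1)) / n) (((n : ℝ) - m) / n)
      (1 / (n : ℝ)) (schemeValue γ c g h s A n m) w '' A)

lemma schemeStep_le (hγ : 0 ≤ γ) (hc : 0 ≤ c) (hcγ : 0 < c + γ)
    (hv : HasRegularDerivs (Set.univ : Set Unit) (fun t w _ => vFun γ c g h t w))
    (hp : HasRegularDerivs A (pFun γ g s)) {u : E d} (hu : u ∈ A)
    {t δ : ℝ} (ht : 0 ≤ t) (hδ : 0 ≤ δ) (ht1 : t + δ ≤ 1) {q : E k → ℝ} {Q : NNReal}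
    (hQ : LipschitzWith Q q) (hq : ∀ x, q x ≤ vFun γ c g h (t + δ) x) (w : E k) :
    schemeStep γ c g s t (t + δ) δ q w u ≤ vFun γ c g h t w := by
  obtain ⟨L, hL⟩ := hv.exists_lipschitzWith
  obtain ⟨M, hM⟩ := hp.exists_lipschitzWith
  have htδ : t + δ ∈ Icc (0 : ℝ) 1 := ⟨by linarith, ht1⟩
  refine le_trans ?_ (step_le hγ hc hcγ hv hp hu ht hδ ht1 w)
  refine add_le_add le_rfl (expUtility_mono hc
    ((hQ.sub (hM _ htδ u hu)).expIntegrable_brownianKernel δ w)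
    (((hL _ htδ () (mem_univ _)).sub (hM _ htδ u hu)).expIntegrable_brownianKernel δ w)
    fun x => sub_le_sub_right (hq x) _)

lemma gridTime_bounds {n m : ℕ} (hm : m + 1 ≤ n) :
    0 ≤ ((n : ℝ) - ((m : ℝ) + 1)) / n ∧ ((n : ℝ) - ((m : ℝ) + 1)) / n < 1 ∧
      ((n : ℝ) - m) / n = ((n : ℝ) - ((m : ℝ) + 1)) / n + 1 / n ∧
      ((n : ℝ) - ((m : ℝ) + 1)) / n + 1 / (n : ℝ) ≤ 1 ∧ (0 : ℝ) ≤ 1 / n := by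
  have hn : (0 : ℝ) < n := Nat.cast_pos.2 (by omega)
  have hmn : (m : ℝ) + 1 ≤ n := by exact_mod_cast hm
  have hm0 : (0 : ℝ) ≤ m := Nat.cast_nonneg m
  have he : ((n : ℝ) - m) / n = ((n : ℝ) - ((m : ℝ) + 1)) / n + 1 / n := by field_simp; ring
  refine ⟨div_nonneg (by linarith) hn.le, ?_, he, ?_, by positivity⟩
  · rw [div_lt_one hn]; linarith
  · rw [← he, div_le_one hn]; linarith

/-- The two claims need a joint induction: the Lipschitz property gives integrability in the next
step, and the upper bound makes the real supremum there a genuine one. The Lipschitz constant may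
grow with `m`; only its finiteness matters. -/
lemma schemeValue_lipschitz_and_le (hγ : 0 ≤ γ) (hc : 0 ≤ c) (hcγ : 0 < c + γ)
    (hA0 : (0 : E d) ∈ A)
    (hv : HasRegularDerivs (Set.univ : Set Unit) (fun t w _ => vFun γ c g h t w))
    (hp : HasRegularDerivs A (pFun γ g s)) {n : ℕ} (hn : 0 < n) (m : ℕ) (hm : m ≤ n) :
    (∃ Q : NNReal, LipschitzWith Q (schemeValue γ c g h s A n m)) ∧
    (∀ w, schemeValue γ c g h s A n m w ≤ vFun γ c g h (((n : ℝ) - m) / n) w) := by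
  have hn' : (0 : ℝ) < n := Nat.cast_pos.2 hn
  obtain ⟨L, hL⟩ := hv.exists_lipschitzWith
  obtain ⟨M, hM⟩ := hp.exists_lipschitzWith
  induction m with
  | zero =>
    have h1 : schemeValue γ c g h s A n 0 = vFun γ c g h 1 := by
      rw [vFun_one]; rfl
    rw [h1]
    refine ⟨⟨L, hL 1 one_mem_unitInterval () (mem_univ _)⟩, fun w => ?_⟩
    simp [hn'.ne']
  | succ m ih =>
    obtain ⟨⟨Q, hQ⟩, hb⟩ := ih (by omega)
    obtain ⟨ht0, ht1', ht', ht1, hδ⟩ := gridTime_bounds hm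
    have hdef : schemeValue γ c g h s A n (m + 1) = fun w => sSup (schemeStep γ c g s
      (((n : ℝ) - ((m : ℝ) + 1)) / n) (((n : ℝ) - m) / n)
      (1 / (n : ℝ)) (schemeValue γ c g h s A n m) w '' A) := rfl
    rw [hdef]
    push_cast
    rw [ht'] at hb ⊢
    set t := ((n : ℝ) - ((m : ℝ) + 1)) / n with ht_def
    set Φ := schemeStep γ c g s t (t + 1 / n) (1 / n) (schemeValue γ c g h s A n m)
    have hup : ∀ w, ∀ u ∈ A, Φ w u ≤ vFun γ c g h t w := fun w u hu =>
      schemeStep_le hγ hc hcγ hv hp hu ht0 hδ ht1 hQ hb w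
    have hbdd : ∀ w, BddAbove (Φ w '' A) := fun w =>
      ⟨vFun γ c g h t w, by rintro _ ⟨u, hu, rfl⟩; exact hup w u hu⟩
    have hne : ∀ w, (Φ w '' A).Nonempty := fun w => ⟨_, mem_image_of_mem _ hA0⟩
    refine ⟨⟨M + (Q + M), LipschitzWith.of_le_add_mul _ fun w w' => ?_⟩, fun w => ?_⟩
    · refine csSup_le (hne w) ?_
      rintro _ ⟨u, hu, rfl⟩
      -- The constant does not depend on `u`, so it passes to the supremum.
      have hl : LipschitzWith (M + (Q + M)) (fun w => Φ w u) :=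
        (hM t ⟨ht0, ht1'.le⟩ u hu).add ((hQ.sub (hM _ ⟨by linarith, ht1⟩ u hu)
          ).expUtility_brownianKernel hc _)
      have h1 := le_csSup (hbdd w') (mem_image_of_mem (Φ w') hu)
      have h2 := hl.dist_le_mul w w'
      rw [Real.dist_eq] at h2
      linarith [(abs_le.1 h2).2]
    · exact csSup_le (hne w) (by rintro _ ⟨u, hu, rfl⟩; exact hup w u hu)

lemma bddAbove_schemeStep (hγ : 0 ≤ γ) (hc : 0 ≤ c) (hcγ : 0 < c + γ) (hA0 : (0 : E d) ∈ A)
    (hv : HasRegularDerivs (Set.univ : Set Unit) (fun t w _ => vFun γ c g h t w))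
    (hp : HasRegularDerivs A (pFun γ g s)) {n m : ℕ} (hm : m + 1 ≤ n) (w : E k) :
    BddAbove (schemeStep γ c g s (((n : ℝ) - ((m : ℝ) + 1)) / n) (((n : ℝ) - m) / n)
      (1 / (n : ℝ)) (schemeValue γ c g h s A n m) w '' A) := by
  obtain ⟨⟨Q, hQ⟩, hb⟩ :=
    schemeValue_lipschitz_and_le hγ hc hcγ hA0 hv hp (by omega : 0 < n) m (by omega)
  obtain ⟨ht0, -, ht', ht1, hδ⟩ := gridTime_bounds hm
  rw [ht'] at hb ⊢
  exact ⟨_, by rintro _ ⟨u, hu, rfl⟩; exact schemeStep_le hγ hc hcγ hv hp hu ht0 hδ ht1 hQ hb w⟩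

/-- Each step loses at most `ε/n`, and cash invariance carries the accumulated loss through the
utility unchanged. -/
lemma le_schemeValue (hγ : 0 ≤ γ) (hc : 0 ≤ c) (hcγ : 0 < c + γ) (hA0 : (0 : E d) ∈ A)
    (hv : HasRegularDerivs (Set.univ : Set Unit) (fun t w _ => vFun γ c g h t w))
    (hp : HasRegularDerivs A (pFun γ g s)) {n : ℕ} (hn : 0 < n) {ε : ℝ}
    (hstep : ∀ t : ℝ, 0 ≤ t → t + 1 / (n : ℝ) ≤ 1 → ∀ w : E k, ∃ u ∈ A,
      vFun γ c g h t w - 1 / (n : ℝ) * ε ≤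
        schemeStep γ c g s t (t + 1 / (n : ℝ)) (1 / (n : ℝ)) (vFun γ c g h (t + 1 / (n : ℝ))) w u)
    (m : ℕ) (hm : m ≤ n) (w : E k) :
    vFun γ c g h (((n : ℝ) - m) / n) w ≤ schemeValue γ c g h s A n m w + m * (1 / (n : ℝ) * ε) := by
  have hn' : (0 : ℝ) < n := Nat.cast_pos.2 hn
  obtain ⟨L, hL⟩ := hv.exists_lipschitzWith
  obtain ⟨M, hM⟩ := hp.exists_lipschitzWith
  induction m generalizing w with
  | zero => simp [hn'.ne', vFun_one, schemeValue]
  | succ m ih =>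
    have hb := ih (by omega)
    obtain ⟨⟨Q, hQ⟩, -⟩ := schemeValue_lipschitz_and_le hγ hc hcγ hA0 hv hp hn m (by omega)
    have hbdd := bddAbove_schemeStep hγ hc hcγ hA0 hv hp hm w
    obtain ⟨ht0, -, ht', ht1, hδ⟩ := gridTime_bounds hm
    rw [schemeValue]
    push_cast
    rw [ht'] at hb hbdd ⊢
    set t := ((n : ℝ) - ((m : ℝ) + 1)) / n with ht_def
    have htδ : t + 1 / n ∈ Icc (0 : ℝ) 1 := ⟨by linarith, ht1⟩
    obtain ⟨u, hu, h2⟩ := hstep t ht0 ht1 w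
    have h3 := le_csSup hbdd (mem_image_of_mem _ hu)
    have h4 := expUtility_le_add_of_le hc
      (((hL _ htδ () (mem_univ _)).sub (hM _ htδ u hu)).expIntegrable_brownianKernel (1 / n) w)
      ((hQ.sub (hM _ htδ u hu)).expIntegrable_brownianKernel (1 / n) w)
      (q := (m : ℝ) * (1 / (n : ℝ) * ε)) fun x => by linarith [hb x]
    unfold schemeStep at h2 h3 ⊢
    linarith

lemma tendsto_schemeValue (hγ : 0 ≤ γ) (hc : 0 ≤ c) (hcγ : 0 < c + γ) (hA0 : (0 : E d) ∈ A)
    (hv : HasRegularDerivs (Set.univ : Set Unit) (fun t w _ => vFun γ c g h t w))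
    (hp : HasRegularDerivs A (pFun γ g s)) {yd : E k × ℝ × E k → E d}
    (hyd : IsCompletenessMap γ g s yd)
    (hAyd : ∀ t ∈ Icc (0 : ℝ) 1, ∀ w : E k,
      yd (w, t, -((c / (c + γ)) • gradient (vFun γ c g h t) w)) ∈ A) (w : E k) :
    Tendsto (fun n => schemeValue γ c g h s A n n w) atTop (𝓝 (vFun γ c g h 0 w)) := by
  rw [Metric.tendsto_atTop]
  intro ε hε
  obtain ⟨δ₀, hδ₀, hstep⟩ := exists_le_step hγ hc hcγ hv hp hyd hAyd (half_pos hε)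
  obtain ⟨N, hN⟩ := exists_nat_one_div_lt hδ₀
  refine ⟨N + 1, fun n hn => ?_⟩
  have hn0 : 0 < n := by omega
  have hn' : (0 : ℝ) < n := Nat.cast_pos.2 hn0
  have hlt : 1 / (n : ℝ) < δ₀ := by
    refine lt_of_le_of_lt ?_ hN
    gcongr
    exact_mod_cast hn
  have h1 := le_schemeValue hγ hc hcγ hA0 hv hp hn0
    (fun t ht ht1 w => hstep t _ ht (by positivity) hlt ht1 w) n le_rfl w
  have h2 := (schemeValue_lipschitz_and_le hγ hc hcγ hA0 hv hp hn0 n le_rfl).2 w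
  rw [sub_self, zero_div] at h1 h2
  rw [← mul_assoc, mul_one_div_cancel hn'.ne', one_mul] at h1
  rw [Real.dist_eq, abs_lt]
  constructor <;> linarith

end Scheme

end IndifferencePricing

end

namespace IndifferencePricing

/-! ### Laws under the regular conditional probability -/

section Conditioning

variable {Ω : Type*} [mΩ : MeasurableSpace Ω] {P : Measure Ω}
  {𝓕 : Filtration ℝ mΩ} {κ : ℝ → Ω → Measure Ω}

/-- Null sets have conditional probability zero almost surely; the measurable hull handles a
non-measurable exceptional set. This moves almost sure identities inside a conditional utility. -/
lemma IsRegularCondProb.ae_ae_of_ae (hκ : IsRegularCondProb P 𝓕 κ) {t : ℝ} (ht : t ∈ Ico (0 : ℝ) 1)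
    {p : Ω → Prop} (hp : ∀ᵐ ω ∂P, p ω) : ∀ᵐ ω ∂P, ∀ᵐ ω' ∂(κ t ω), p ω' := by
  set N := toMeasurable P {ω | ¬p ω}
  have hN : P N = 0 := by rw [measure_toMeasurable]; exact ae_iff.1 hp
  have hind : N.indicator (fun _ => (1 : ℝ)) =ᵐ[P] 0 := indicator_meas_zero hN
  have h1 := hκ.condExp t ht N (measurableSet_toMeasurable _ _)
  have h2 := condExp_congr_ae (m := 𝓕 t) hind
  rw [condExp_zero] at h2
  filter_upwards [h1, h2] with ω e1 e2
  have := hκ.isProbabilityMeasure t ht ω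
  rw [e2, Pi.zero_apply, measureReal_eq_zero_iff] at e1
  exact ae_iff.2 (measure_mono_null (subset_toMeasurable _ _) e1)

/-- A countable generating algebra leaves one null set for all its members, and it is a π-system,
hence determines the law. -/
lemma IsRegularCondProb.ae_map_eq (hκ : IsRegularCondProb P 𝓕 κ) {t : ℝ}
    (ht : t ∈ Ico (0 : ℝ) 1) {β : Type*} [MeasurableSpace β]
    [hβ : MeasurableSpace.CountablyGenerated β] {X : Ω → β} (hX : Measurable X)
    {ν : Ω → Measure β} (hν : ∀ ω, IsProbabilityMeasure (ν ω))
    (h : ∀ B : Set β, MeasurableSet B →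
      P[(X ⁻¹' B).indicator (fun _ => (1 : ℝ)) | 𝓕 t] =ᵐ[P] fun ω => (ν ω).real B) :
    ∀ᵐ ω ∂P, (κ t ω).map X = ν ω := by
  obtain ⟨b, hbc, hb⟩ := hβ.isCountablyGenerated
  have hgen : ‹MeasurableSpace β› = MeasurableSpace.generateFrom (generateSetAlgebra b) := by
    rw [generateFrom_generateSetAlgebra_eq, ← hb]
  have hmeas : ∀ B ∈ generateSetAlgebra b, MeasurableSet B := fun B hB => by
    rw [hgen]; exact MeasurableSpace.measurableSet_generateFrom hB
  have hall : ∀ᵐ ω ∂P, ∀ B ∈ generateSetAlgebra b, (κ t ω).real (X ⁻¹' B) = (ν ω).real B := by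
    rw [ae_ball_iff (countable_generateSetAlgebra hbc)]
    intro B hB
    exact (hκ.condExp t ht _ (hX (hmeas B hB))).trans (h B (hmeas B hB))
  filter_upwards [hall] with ω hω
  have := hκ.isProbabilityMeasure t ht ω
  have := hν ω
  have := Measure.isProbabilityMeasure_map (μ := κ t ω) hX.aemeasurable
  refine ext_of_generate_finite _ hgen
    isSetAlgebra_generateSetAlgebra.isSetRing.isSetSemiring.isPiSystem (fun B hB => ?_) (by simp)
  rw [Measure.map_apply hX (hmeas B hB)]
  exact (measureReal_eq_measureReal_iff).1 (hω B hB)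

lemma IsRegularCondProb.ae_map_eq_dirac [IsProbabilityMeasure P]
    (hκ : IsRegularCondProb P 𝓕 κ) {t : ℝ}
    (ht : t ∈ Ico (0 : ℝ) 1) {β : Type*} [MeasurableSpace β]
    [MeasurableSpace.CountablyGenerated β] {X : Ω → β} (hX : Measurable[𝓕 t] X) :
    ∀ᵐ ω ∂P, (κ t ω).map X = Measure.dirac (X ω) := by
  have hX' : Measurable X := hX.mono (𝓕.le t) le_rfl
  refine hκ.ae_map_eq ht hX' (fun ω => inferInstance) fun B hB => ?_
  rw [condExp_of_stronglyMeasurable (𝓕.le t)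
    (stronglyMeasurable_const.indicator (hX hB))
    ((integrable_const _).indicator (hX' hB))]
  refine ae_of_all _ fun ω => ?_
  by_cases hω : X ω ∈ B <;> simp [Measure.real, Measure.dirac_apply' _ hB, hω]

lemma IsRegularCondProb.ae_map_eq_of_indep [IsProbabilityMeasure P]
    (hκ : IsRegularCondProb P 𝓕 κ) {t : ℝ}
    (ht : t ∈ Ico (0 : ℝ) 1) {β : Type*} [mβ : MeasurableSpace β]
    [MeasurableSpace.CountablyGenerated β] {X : Ω → β} (hX : Measurable X)
    (hind : Indep (MeasurableSpace.comap X mβ) (𝓕 t) P) :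
    ∀ᵐ ω ∂P, (κ t ω).map X = P.map X := by
  refine hκ.ae_map_eq ht hX (fun ω => Measure.isProbabilityMeasure_map hX.aemeasurable)
    fun B hB => ?_
  refine (condExp_indep_eq hX.comap_le (𝓕.le t)
    (stronglyMeasurable_const.indicator ⟨B, hB, rfl⟩) hind).trans (ae_of_all _ fun ω => ?_)
  simp only [Measure.real]
  rw [Measure.map_apply hX hB, integral_indicator (hX hB)]
  simp [Measure.real]

variable {k : ℕ} {W : ℝ → Ω → E k}

lemma IsBrownianMotion.measurable (hW : IsBrownianMotion P 𝓕 W) {t : ℝ} (ht : t ∈ Icc (0 : ℝ) 1) :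
    Measurable (W t) := (hW.adapted t ht).mono (𝓕.le t) le_rfl

/-- Under the regular conditional probability at time `t`, the present value of the Brownian motion
is known and its future values are normal. -/
lemma IsBrownianMotion.ae_condLaw [IsProbabilityMeasure P]
    (hW : IsBrownianMotion P 𝓕 W) (hκ : IsRegularCondProb P 𝓕 κ)
    {t t' : ℝ} (ht : t ∈ Ico (0 : ℝ) 1) (htt : t ≤ t') (ht' : t' ≤ 1) :
    ∀ᵐ ω ∂P, (∀ᵐ ω' ∂(κ t ω), W t ω' = W t ω) ∧
      (κ t ω).map (W t') = brownianKernel (t' - t) (W t ω) := by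
  have hWt := hW.measurable (t := t) ⟨ht.1, ht.2.le⟩
  have hWt' := hW.measurable (t := t') ⟨ht.1.trans htt, ht'⟩
  filter_upwards [hκ.ae_map_eq_dirac ht (hW.adapted t ⟨ht.1, ht.2.le⟩),
    hκ.ae_map_eq_of_indep ht (hWt'.sub hWt) (hW.indep t t' ht.1 htt ht')] with ω h1 h2
  have hae : ∀ᵐ ω' ∂(κ t ω), W t ω' = W t ω := by
    have : ∀ᵐ x ∂((κ t ω).map (W t)), x = W t ω := by rw [h1, ae_dirac_eq]; rfl
    exact ae_of_ae_map hWt.aemeasurable this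
  refine ⟨hae, ?_⟩
  have h3 : P.map (W t' - W t) = brownianKernel (t' - t) 0 := hW.law t t' ht.1 htt ht'
  rw [h3] at h2
  -- Under `κ t ω`, `W t'` is the frozen value `W t ω` plus the increment.
  have h4 := map_const_add_brownianKernel (t' - t) (W t ω) 0
  rw [add_zero, ← h2, Measure.map_map (by fun_prop) (hWt'.sub hWt)] at h4
  rw [← h4]
  refine Measure.map_congr (hae.mono fun ω' hω' => ?_)
  simp [hω']

end Conditioning

/-! ### Reduction of the dynamic programming to the scheme -/

section DynamicProgramming

variable {Ω : Type*} [mΩ : MeasurableSpace Ω] {P : Measure Ω}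
  {𝓕 : Filtration ℝ mΩ} {κ : ℝ → Ω → Measure Ω} {k d : ℕ} {W : ℝ → Ω → E k} {γ c : ℝ}
  {s : E k → E d} {g h : E k → ℝ} {A : Set (E d)}

lemma sInf_indifference (a b : ℝ) : sInf {q : ℝ | a ≤ b + q} = a - b := by
  have : {q : ℝ | a ≤ b + q} = Ici (a - b) := by
    ext q; simp only [mem_ofPred_eq, mem_Ici, sub_le_iff_le_add']
  rw [this, csInf_Ici]

/-- By cash invariance the acceptable prices form a closed half-line starting at the utility
difference. Membership in `A` supplies the Lipschitz payoffs that make these utilities finite. -/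
lemma price_eq (hp : HasRegularDerivs A (pFun γ g s)) {t : ℝ} {ω : Ω}
    (hW1 : Measurable (W 1)) (hlaw : (κ t ω).map (W 1) = brownianKernel (1 - t) (W t ω))
    {z y : E d} (hz : -z ∈ A) (hy : y - z ∈ A) :
    price κ γ (fun ω => g (W 1 ω)) (fun ω => s (W 1 ω)) t z y ω =
      pFun γ g s t (W t ω) (-z) - pFun γ g s t (W t ω) (y - z) := by
  obtain ⟨M, hM⟩ := hp.exists_lipschitzWith
  have hl : ∀ u ∈ A, LipschitzWith M (fun x => g x - inner ℝ u (s x)) := fun u hu => by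
    simpa only [pFun_one] using hM 1 one_mem_unitInterval u hu
  have hU : ∀ u ∈ A, ∀ q : ℝ, expUtility γ (κ t ω)
      (fun ω' => g (W 1 ω') - inner ℝ u (s (W 1 ω')) + q) = pFun γ g s t (W t ω) u + q := by
    intro u hu q
    rw [pFun, ← expUtility_add_const _ _ ((hl u hu).expIntegrable_brownianKernel _ _), ← hlaw,
      expUtility_map γ hW1.aemeasurable ((hl u hu).continuous.measurable.add_const q).aemeasurable]
  have e1 := hU (-z) hz 0
  simp only [inner_neg_left, sub_neg_eq_add, add_zero] at e1
  have e2 : ∀ q : ℝ, expUtility γ (κ t ω) (fun ω' => g (W 1 ω') + inner ℝ z (s (W 1 ω')) -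
      inner ℝ y (s (W 1 ω')) + q) = pFun γ g s t (W t ω) (y - z) + q := fun q => by
    rw [← hU (y - z) hy q]
    congr 1 with ω'
    rw [inner_sub_left]; ring
  simp only [price, condUtility, e1, e2]
  exact sInf_indifference _ _

lemma sSup_image_const_add {β : Type*} {B : Set β} (hB : B.Nonempty) {f : β → ℝ}
    (hf : BddAbove (f '' B)) (r : ℝ) : sSup ((fun u => r + f u) '' B) = r + sSup (f '' B) := by
  have h : (fun u => r + f u) '' B = (fun x => r + x) '' (f '' B) := by rw [image_image]
  rw [h]
  exact ((OrderIso.addLeft r).map_csSup' (hB.image f) hf).symm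

/-- The dynamic programming value is the cash, less the supplier's utility level, plus a Lipschitz
function of the Brownian motion. -/
lemma dpRemaining_eq [IsProbabilityMeasure P]
    (hκ : IsRegularCondProb P 𝓕 κ) (hW : IsBrownianMotion P 𝓕 W)
    (hγ : 0 ≤ γ) (hc : 0 ≤ c) (hcγ : 0 < c + γ) (hA0 : (0 : E d) ∈ A)
    (hv : HasRegularDerivs (Set.univ : Set Unit) (fun t w _ => vFun γ c g h t w))
    (hp : HasRegularDerivs A (pFun γ g s)) {n : ℕ} (hn : 0 < n) (m : ℕ) (hm : m ≤ n) :
    ∀ᵐ ω ∂P, ∀ x : ℝ, ∀ z : E d, -z ∈ A →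
      dpRemaining κ γ c A (fun ω => g (W 1 ω)) (fun ω => h (W 1 ω)) (fun ω => s (W 1 ω)) n m x z ω =
        x - pFun γ g s (((n : ℝ) - m) / n) (W (((n : ℝ) - m) / n) ω) (-z) +
          schemeValue γ c g h s A n m (W (((n : ℝ) - m) / n) ω) := by
  have hn' : (n : ℝ) ≠ 0 := (Nat.cast_pos.2 hn).ne'
  induction m with
  | zero =>
    refine ae_of_all _ fun ω x z _ => ?_
    simp only [Nat.cast_zero, sub_zero, div_self hn', pFun_one, dpRemaining, schemeValue,
      inner_neg_left]
    ring
  | succ m ih =>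
    obtain ⟨⟨Q, hQ⟩, -⟩ := schemeValue_lipschitz_and_le hγ hc hcγ hA0 hv hp hn m (by omega)
    obtain ⟨M, hM⟩ := hp.exists_lipschitzWith
    have hbdd := bddAbove_schemeStep hγ hc hcγ hA0 hv hp hm
    have ih := ih (by omega)
    obtain ⟨ht0, ht1', ht', ht1, hδ⟩ := gridTime_bounds hm
    have hW1 := hW.measurable one_mem_unitInterval
    simp only [schemeValue, dpRemaining]
    push_cast
    rw [ht'] at hbdd ih ⊢
    set t := ((n : ℝ) - ((m : ℝ) + 1)) / n with ht_def
    set q := schemeValue γ c g h s A n m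
    have ht : t ∈ Ico (0 : ℝ) 1 := ⟨ht0, ht1'⟩
    have htδ : t + 1 / n ∈ Icc (0 : ℝ) 1 := ⟨by linarith, ht1⟩
    have hlaw1 := hW.ae_condLaw hκ ht ht1'.le le_rfl
    -- The price is evaluated at `ω'` inside the utility, so the law of `W 1` is needed under `κ t
    -- ω'` for `κ t ω`-almost every `ω'`. One null set serves all `x` and `z`, since the cash is
    -- random and `y` ranges over a possibly uncountable set.
    filter_upwards [hW.ae_condLaw hκ ht (by linarith : t ≤ t + 1 / n) ht1, hκ.ae_ae_of_ae ht ih,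
      hκ.ae_ae_of_ae ht hlaw1] with ω hω hih hω1 x z hz
    obtain ⟨hpres, hlaw⟩ := hω
    have := hκ.isProbabilityMeasure t ht ω
    rw [add_sub_cancel_left] at hlaw
    -- The price contributes `-p(t,·,-z) + p(t,·,y-z)` and the induction hypothesis
    -- `-p(t+1/n,·,y-z)`; the last two are the terms of `schemeStep` at `u = y - z`.
    have key : ∀ y : E d, y - z ∈ A → condUtility κ c t (fun ω' =>
        dpRemaining κ γ c A (fun ω => g (W 1 ω)) (fun ω => h (W 1 ω)) (fun ω => s (W 1 ω)) n m
          (x - price κ γ (fun ω => g (W 1 ω)) (fun ω => s (W 1 ω)) t z y ω') (z - y) ω') ω =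
        x - pFun γ g s t (W t ω) (-z) +
          schemeStep γ c g s t (t + 1 / n) (1 / n) q (W t ω) (y - z) := by
      intro y hy
      have hl : LipschitzWith (Q + M) (fun w => q w - pFun γ g s (t + 1 / n) w (y - z)) :=
        hQ.sub (hM _ htδ _ hy)
      set r := x - pFun γ g s t (W t ω) (-z) + pFun γ g s t (W t ω) (y - z)
      have hae : (fun ω' =>
          dpRemaining κ γ c A (fun ω => g (W 1 ω)) (fun ω => h (W 1 ω)) (fun ω => s (W 1 ω)) n m
            (x - price κ γ (fun ω => g (W 1 ω)) (fun ω => s (W 1 ω)) t z y ω') (z - y) ω')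
          =ᵐ[κ t ω] fun ω' => q (W (t + 1 / n) ω') -
            pFun γ g s (t + 1 / n) (W (t + 1 / n) ω') (y - z) + r := by
        filter_upwards [hpres, hih, hω1] with ω' h1 h2 h3
        rw [h2 _ (z - y) (by rwa [neg_sub]), price_eq hp hW1 h3.2 hz hy, h1, neg_sub]
        simp only [r]
        ring
      rw [condUtility, expUtility_congr c hae, ← expUtility_map (X := W (t + 1 / n))
        (f := fun w => q w - pFun γ g s (t + 1 / n) w (y - z) + r) c
        (hW.measurable htδ).aemeasurable (hl.continuous.measurable.add_const r).aemeasurable,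
        hlaw, expUtility_add_const c r (hl.expIntegrable_brownianKernel _ _), schemeStep]
      simp only [r]
      ring
    rw [image_congr (fun y (hy : y ∈ {y : E d | y - z ∈ A}) => key y hy),
      ← sSup_image_const_add ⟨0, hA0⟩ (hbdd (W t ω))]
    congr 1
    ext r
    constructor
    · rintro ⟨y, hy, rfl⟩
      exact ⟨y - z, hy, rfl⟩
    · rintro ⟨u, hu, rfl⟩
      exact ⟨u + z, by simpa using hu, by simp⟩

end DynamicProgramming

end IndifferencePricing

/-! ### Conclusion -/

open IndifferencePricing in
theorem mainTheorem4 {Ω : Type*} [mΩ : MeasurableSpace Ω] (P : Measure Ω) [IsProbabilityMeasure P]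
    (𝓕 : Filtration ℝ mΩ) (κ : ℝ → Ω → Measure Ω) (hκ : IsRegularCondProb P 𝓕 κ)
    {k d : ℕ} (W : ℝ → Ω → E k) (hW : IsBrownianMotion P 𝓕 W)
    (γ c : ℝ) (hγ : 0 ≤ γ) (hc : 0 ≤ c) (hcγ : 0 < c + γ)
    (s : E k → E d) (g h : E k → ℝ) (hs : Measurable s) (hg : Measurable g) (hh : Measurable h)
    (S : Ω → E d) (G H : Ω → ℝ)
    (hS : S = fun ω => s (W 1 ω)) (hG : G = fun ω => g (W 1 ω)) (hH : H = fun ω => h (W 1 ω))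
    (hSexp : HasExpMoments P S) (hGexp : HasExpMoments P G) (hHexp : HasExpMoments P H)
    (A : Set (E d)) (hA : IsCompact A) (hA0 : (0 : E d) ∈ A)
    (hv : HasRegularDerivs (Set.univ : Set Unit) (fun t w _ => vFun γ c g h t w))
    (hp : HasRegularDerivs A (pFun γ g s))
    (yd : E k × ℝ × E k → E d) (hyd : IsCompletenessMap γ g s yd)
    (hAyd : ∀ t ∈ Set.Icc (0 : ℝ) 1, ∀ w : E k,
      yd (w, t, -((c / (c + γ)) • gradient (vFun γ c g h t) w)) ∈ A) :
    ∀ᵐ ω ∂P,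
      Tendsto (fun n : ℕ => dpValue κ γ c A G H S n 0 0 0 ω) atTop
        (𝓝 (vFun γ c g h 0 (W 0 ω) - pFun γ g s 0 (W 0 ω) 0)) ∧
      vFun γ c g h 0 (W 0 ω) - pFun γ g s 0 (W 0 ω) 0 =
        condUtility κ (c * γ / (c + γ)) 0 (fun ω' => G ω' + H ω') ω - condUtility κ γ 0 G ω := by
  subst hS hG hH
  have hdp : ∀ᵐ ω ∂P, ∀ n : ℕ, 0 < n →
      dpValue κ γ c A (fun ω => g (W 1 ω)) (fun ω => h (W 1 ω)) (fun ω => s (W 1 ω)) n 0 0 0 ω =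
        schemeValue γ c g h s A n n (W 0 ω) - pFun γ g s 0 (W 0 ω) 0 := by
    rw [ae_all_iff]
    intro n
    -- There is no grid for `n = 0`, and the limit ignores it.
    rcases Nat.eq_zero_or_pos n with rfl | hn
    · exact ae_of_all _ fun ω hn => absurd hn (lt_irrefl 0)
    filter_upwards [dpRemaining_eq hκ hW hγ hc hcγ hA0 hv hp hn n le_rfl] with ω hω _
    have h1 := hω 0 0 (by simpa using hA0)
    rw [sub_self, zero_div, neg_zero] at h1
    rw [dpValue, mul_zero, Nat.floor_zero, Nat.sub_zero, h1]
    ring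
  have h01 : (0 : ℝ) ∈ Ico (0 : ℝ) 1 := ⟨le_rfl, one_pos⟩
  filter_upwards [hdp, hW.ae_condLaw hκ h01 zero_le_one le_rfl] with ω hω hlaw
  refine ⟨?_, ?_⟩
  · refine ((tendsto_schemeValue hγ hc hcγ hA0 hv hp hyd hAyd (W 0 ω)).sub_const
      (pFun γ g s 0 (W 0 ω) 0)).congr' ?_
    filter_upwards [eventually_gt_atTop 0] with n hn
    exact (hω n hn).symm
  · have hW1 := (hW.measurable one_mem_unitInterval).aemeasurable (μ := κ 0 ω)
    simp only [vFun, pFun, condUtility, inner_zero_left, sub_zero]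
    have h2 := hlaw.2
    rw [sub_zero] at h2
    rw [← h2, expUtility_map _ hW1 (f := fun x => g x + h x) (hg.add hh).aemeasurable,
      expUtility_map _ hW1 hg.aemeasurable]
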